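/- Let $a,b,c$ be real numbers with $c\notin\mathbb Z$ and $c-a-b\notin\mathbb Z$. Consider the equation $$\partial_z^2 T(z)+\frac{c-z(a+b+1)}{z(1-z)}\,\partial_z T(z)-\frac{ab}{z(1-z)}\,T(z)=0,\qquad z\in\mathbb C\setminus\{0,1\},\qquad (\ast)$$ for real-valued functions $T$ of class $C^2$ on $\mathbb C\setminus\{0,1\}$, where $z=x+iy$ and $\partial_z=\frac12(\partial_x-i\partial_y)$. Let $$F_-(z)={}_2F_1(a,b,c,z),\qquad F_+(z)=z^{1-c}\,{}_2F_1(1+a-c,1+b-c,2-c,z),$$ where ${}_2F_1$ denotes the holomorphic continuation of the Gauss hypergeometric series from the unit disc to $\mathbb C\setminus[1,\infty)$ and $z^{1-c}$ is the principal branch. Then every real-valued solution $T$ of $(\ast)$ on $\mathbb C\setminus\{0,1\}$ can be written as $$T(z)=\lambda_1|F_-(z)|^2+\lambda_2|F_+(z)|^2$$ with real numbers $\lambda_1,\lambda_2$ satisfying $$\lambda_1\,\frac{\Gamma(c)^2}{\Gamma(c-a)\Gamma(c-b)\Gamma(a)\Gamma(b)}+\lambda_2\,\frac{\Gamma(2-c)^2}{\Gamma(1-a)\Gamma(1-b)\Gamma(a-c+1)\Gamma(b-c+1)}=0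 ,$$ where $1/\Gamma$ is understood to be $0$ at the poles of $\Gamma$; the formula for $T$ holds at every $z\in\mathbb C\setminus\{0,1\}$ off the cut $(1,\infty)$, and at the points of the cut it holds in the sense of limits from $\mathbb C\setminus[1,\infty)$. In particular, if at least one of the two coefficients in front of $\lambda_1,\lambda_2$ is nonzero, then the real vector space of real-valued solutions of $(\ast)$ on $\mathbb C\setminus\{0,1\}$ has dimension exactly one. -/

import Mathlib

namespace HypergeoPDE

noncomputable section

/-- The domain `ℂ ∖ {0, 1}`. -/
def puncturedPlane : Set ℂ := {0, 1}ᶜ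

/-- The cut plane `ℂ ∖ [1, ∞)`. -/
def cutPlane : Set ℂ := {z : ℂ | ¬ (z.im = 0 ∧ 1 ≤ z.re)}

/-- The Wirtinger derivative `∂_z f = (∂_x f - i ∂_y f) / 2` of a function of `z = x + i y`. -/
def dz (f : ℂ → ℂ) (z : ℂ) : ℂ :=
  (fderiv ℝ f z 1 - Complex.I * fderiv ℝ f z Complex.I) / 2

/-- `T` is a real-valued classical (`C²`) solution on `ℂ ∖ {0, 1}` of
`∂_z² T + (c - z (a + b + 1)) / (z (1 - z)) ∂_z T - a b / (z (1 - z)) T = 0`. The values of `T`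
at `0` and `1` play no role. -/
def IsSolution (a b c : ℝ) (T : ℂ → ℝ) : Prop :=
  ContDiffOn ℝ 2 T puncturedPlane ∧
  ∀ z ∈ puncturedPlane,
    dz (dz (fun w => (T w : ℂ))) z
      + ((c : ℂ) - z * ((a : ℂ) + (b : ℂ) + 1)) / (z * (1 - z)) * dz (fun w => (T w : ℂ)) z
      - ((a : ℂ) * (b : ℂ)) / (z * (1 - z)) * (T z : ℂ) = 0

/-- `F` is holomorphic on `ℂ ∖ [1, ∞)` and is given on the open unit disc by the Gauss
hypergeometric series with parameters `a, b, c`. -/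
def IsContinuation (a b c : ℝ) (F : ℂ → ℂ) : Prop :=
  DifferentiableOn ℂ F cutPlane ∧
  ∀ z : ℂ, ‖z‖ < 1 → F z = ordinaryHypergeometric (a : ℂ) (b : ℂ) (c : ℂ) z

open Classical in
/-- The Gauss hypergeometric function `₂F₁(a, b, c, ·)` on `ℂ ∖ [1, ∞)`: the holomorphic
continuation of the hypergeometric series to this (connected) set, which is unique there. -/
def gauss2F1 (a b c : ℝ) (z : ℂ) : ℂ :=
  if h : ∃ F : ℂ → ℂ, IsContinuation a b c F then h.choose z else 0

/-- `F₋(z) = ₂F₁(a, b, c, z)`. -/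
def Fminus (a b c : ℝ) (z : ℂ) : ℂ := gauss2F1 a b c z

/-- `F₊(z) = z^(1-c) ₂F₁(1 + a - c, 1 + b - c, 2 - c, z)`, with the principal branch of the
power. -/
def Fplus (a b c : ℝ) (z : ℂ) : ℂ :=
  z ^ (1 - (c : ℂ)) * gauss2F1 (1 + a - c) (1 + b - c) (2 - c) z

/-- The function `λ₁ |F₋|² + λ₂ |F₊|²`. -/
def combination (a b c l₁ l₂ : ℝ) (z : ℂ) : ℝ :=
  l₁ * ‖Fminus a b c z‖ ^ 2 + l₂ * ‖Fplus a b c z‖ ^ 2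

/-- `T = λ₁ |F₋|² + λ₂ |F₊|²` on `ℂ ∖ {0, 1}`: equality at every point off the cut `(1, ∞)` of
`F₋, F₊`, and on that cut `T` is the limit of the right-hand side from off the cut. -/
def HasForm (a b c l₁ l₂ : ℝ) (T : ℂ → ℝ) : Prop :=
  (∀ z ∈ puncturedPlane ∩ cutPlane, T z = combination a b c l₁ l₂ z) ∧
  ∀ x : ℝ, 1 < x →
    Filter.Tendsto (combination a b c l₁ l₂) (nhdsWithin (x : ℂ) cutPlane) (nhds (T x))

/-- The coefficient of `λ₁`. Mathlib's `Real.Gamma` is `0` at the poles of `Γ` and `x / 0 = 0`,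
so that `1 / Γ` is `0` at these poles, as usual. -/
def coeffMinus (a b c : ℝ) : ℝ :=
  Real.Gamma c ^ 2 /
    (Real.Gamma (c - a) * Real.Gamma (c - b) * Real.Gamma a * Real.Gamma b)

/-- The coefficient of `λ₂`, with the same convention. -/
def coeffPlus (a b c : ℝ) : ℝ :=
  Real.Gamma (2 - c) ^ 2 /
    (Real.Gamma (1 - a) * Real.Gamma (1 - b) * Real.Gamma (a - c + 1) * Real.Gamma (b - c + 1))

theorem isOpen_puncturedPlane : IsOpen puncturedPlane :=
  (Set.toFinite ({0, 1} : Set ℂ)).isClosed.isOpen_compl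

theorem dz_add {f g : ℂ → ℂ} {z : ℂ} (hf : DifferentiableAt ℝ f z)
    (hg : DifferentiableAt ℝ g z) : dz (fun w => f w + g w) z = dz f z + dz g z := by
  unfold dz
  rw [fderiv_fun_add hf hg]
  simp only [add_apply]
  ring

theorem dz_const_mul {f : ℂ → ℂ} {z : ℂ} (k : ℂ) (hf : DifferentiableAt ℝ f z) :
    dz (fun w => k * f w) z = k * dz f z := by
  unfold dz
  rw [fderiv_const_mul hf]
  simp only [smul_apply, smul_eq_mul]
  ring

theorem dz_congr {f g : ℂ → ℂ} {z : ℂ} (h : f =ᶠ[nhds z] g) : dz f z = dz g z := by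
  unfold dz
  rw [h.fderiv_eq]

theorem contDiffAt_ofReal {T : ℂ → ℝ} (hT : ContDiffOn ℝ 2 T puncturedPlane) {z : ℂ}
    (hz : z ∈ puncturedPlane) : ContDiffAt ℝ 2 (fun w => (T w : ℂ)) z :=
  Complex.ofRealCLM.contDiff.contDiffAt.comp z
    (hT.contDiffAt (isOpen_puncturedPlane.mem_nhds hz))

theorem differentiableAt_ofReal {T : ℂ → ℝ} (hT : ContDiffOn ℝ 2 T puncturedPlane) {z : ℂ}
    (hz : z ∈ puncturedPlane) : DifferentiableAt ℝ (fun w => (T w : ℂ)) z :=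
  (contDiffAt_ofReal hT hz).differentiableAt (by norm_num)

theorem differentiableAt_dz_ofReal {T : ℂ → ℝ} (hT : ContDiffOn ℝ 2 T puncturedPlane) {z : ℂ}
    (hz : z ∈ puncturedPlane) : DifferentiableAt ℝ (dz (fun w => (T w : ℂ))) z := by
  have h : DifferentiableAt ℝ (fderiv ℝ (fun w => (T w : ℂ))) z :=
    ((contDiffAt_ofReal hT hz).fderiv_right (m := 1) (by norm_num)).differentiableAt
      (by norm_num)
  unfold dz
  simp only [div_eq_mul_inv]
  exact ((h.clm_apply (differentiableAt_const _)).sub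
    ((h.clm_apply (differentiableAt_const _)).const_mul _)).mul_const _

theorem IsSolution.add {a b c : ℝ} {S T : ℂ → ℝ} (hS : IsSolution a b c S)
    (hT : IsSolution a b c T) : IsSolution a b c (S + T) := by
  refine ⟨hS.1.add hT.1, fun z hz => ?_⟩
  have e : ∀ w ∈ puncturedPlane, dz (fun w => ((S + T) w : ℂ)) w
      = dz (fun w => (S w : ℂ)) w + dz (fun w => (T w : ℂ)) w := fun w hw => by
    simpa only [Pi.add_apply, Complex.ofReal_add] using
      dz_add (differentiableAt_ofReal hS.1 hw) (differentiableAt_ofReal hT.1 hw)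
  have e2 := dz_congr (Filter.eventually_of_mem (isOpen_puncturedPlane.mem_nhds hz) e)
  rw [dz_add (differentiableAt_dz_ofReal hS.1 hz) (differentiableAt_dz_ofReal hT.1 hz)] at e2
  rw [e2, e z hz, Pi.add_apply, Complex.ofReal_add]
  linear_combination hS.2 z hz + hT.2 z hz

theorem IsSolution.smul {a b c : ℝ} {T : ℂ → ℝ} (k : ℝ) (hT : IsSolution a b c T) :
    IsSolution a b c (k • T) := by
  refine ⟨hT.1.const_smul k, fun z hz => ?_⟩
  have e : ∀ w ∈ puncturedPlane, dz (fun w => ((k • T) w : ℂ)) w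
      = (k : ℂ) * dz (fun w => (T w : ℂ)) w := fun w hw => by
    simpa only [Pi.smul_apply, smul_eq_mul, Complex.ofReal_mul] using
      dz_const_mul (k : ℂ) (differentiableAt_ofReal hT.1 hw)
  have e2 := dz_congr (Filter.eventually_of_mem (isOpen_puncturedPlane.mem_nhds hz) e)
  rw [dz_const_mul (k : ℂ) (differentiableAt_dz_ofReal hT.1 hz)] at e2
  rw [e2, e z hz, Pi.smul_apply, smul_eq_mul, Complex.ofReal_mul]
  linear_combination (k : ℂ) * hT.2 z hz

theorem isSolution_zero (a b c : ℝ) : IsSolution a b c 0 := by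
  refine ⟨contDiffOn_const, fun z _ => ?_⟩
  have e : dz (fun w => (((0 : ℂ → ℝ) w : ℝ) : ℂ)) = fun _ => 0 := by
    funext w
    simp [dz]
  rw [e]
  simp [dz]

/-- The real vector space of real-valued solutions on `ℂ ∖ {0, 1}`, as functions on that set. -/
def solutionSpace (a b c : ℝ) : Submodule ℝ (puncturedPlane → ℝ) where
  carrier := {u | ∃ T : ℂ → ℝ, IsSolution a b c T ∧ ∀ z : puncturedPlane, u z = T z}
  add_mem' := by
    rintro u v ⟨S, hS, hu⟩ ⟨T, hT, hv⟩
    exact ⟨S + T, hS.add hT, fun z => by simp [hu z, hv z]⟩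
  zero_mem' := ⟨0, isSolution_zero a b c, fun _ => rfl⟩
  smul_mem' := by
    rintro k u ⟨T, hT, hu⟩
    exact ⟨k • T, hT.smul k, fun z => by simp [hu z]⟩

end

end HypergeoPDE

namespace HypergeoPDE

open Filter Topology ComplexConjugate

noncomputable section

/-! The equation involves only `∂_z`, so antiholomorphic functions behave as constants. If `f₁, f₂`
are independent holomorphic solutions on a connected open set, Cramer's rule and the reality of `T`
give `T = B₁ conj f₁ + B₂ conj f₂` with `B₁, B₂` holomorphic. The equation then forces `B₁, B₂` to
be hypergeometric solutions as well, so `T` is a constant bilinear form in the `fᵢ` and `conj fⱼ`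
(`exists_bilinear_form`).

Single-valuedness around `0` removes the cross terms: crossing the negative axis multiplies `F₊` by
different phases from above and from below, and these differ because `c` is not an integer. This
leaves `λ₁|F₋|² + λ₂|F₊|²` (`IsSolution.exists_eq_combination`). The same argument applied to `T(1 -
z)`, with `a + b - c + 1` in place of `c`, shows that `T` is diagonal in the basis at `1` too. The
connection formulas have real coefficients, and the cross coefficient they produce at `1` is the
stated linear form in `λ₁, λ₂` times `Γ(c-a-b) Γ(a+b-c) ≠ 0` (`condition_of_reflected_eq`).
Conversely, when this form vanishes, the expression in the basis at `1` is diagonal and continues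
`T` smoothly across `(1, ∞)` (`exists_isSolution_hasForm`). Solutions thus correspond to the kernel
of one linear form on `ℝ²`, which gives the dimension.

Two classical facts are proved on the way. The continuation of `₂F₁` comes from the conformal map `z
= 4w/(1+w)²` of the disc onto the cut plane, under which the equation becomes a three-term
recurrence with radius of convergence at least `1` (`exists_isContinuation`). The connection
coefficients are found by shifting `c` to `c + N` with contiguous relations and letting `N → ∞`,
where `₂F₁ → 1` and Euler's product yields the Gamma quotients (`IsConnection.fst_eq`,
`isConnection_gammaRatio`). -/

/-! ### Taylor coefficients at `0`. -/

/-- The `n`-th Taylor coefficient of `f` at `0`. -/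
def taylorCoeff (f : ℂ → ℂ) (n : ℕ) : ℂ := iteratedDeriv n f 0 / n.factorial

theorem taylorCoeff_zero (f : ℂ → ℂ) : taylorCoeff f 0 = f 0 := by
  simp [taylorCoeff]

theorem taylorCoeff_congr {f g : ℂ → ℂ} (h : f =ᶠ[𝓝 0] g) : taylorCoeff f = taylorCoeff g := by
  funext n
  rw [taylorCoeff, taylorCoeff, h.iteratedDeriv_eq]

theorem taylorCoeff_add {f g : ℂ → ℂ} (hf : AnalyticAt ℂ f 0) (hg : AnalyticAt ℂ g 0) (n : ℕ) :
    taylorCoeff (fun z => f z + g z) n = taylorCoeff f n + taylorCoeff g n := by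
  rw [taylorCoeff, iteratedDeriv_fun_add hf.contDiffAt hg.contDiffAt, add_div]
  rfl

theorem taylorCoeff_const_mul (k : ℂ) (f : ℂ → ℂ) (n : ℕ) :
    taylorCoeff (fun z => k * f z) n = k * taylorCoeff f n := by
  rw [taylorCoeff, iteratedDeriv_const_mul_field, mul_div_assoc]
  rfl

theorem taylorCoeff_deriv (f : ℂ → ℂ) (n : ℕ) :
    taylorCoeff (deriv f) n = (n + 1) * taylorCoeff f (n + 1) := by
  rw [taylorCoeff, taylorCoeff, ← iteratedDeriv_succ', Nat.factorial_succ]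
  have : (n : ℂ) + 1 ≠ 0 := by exact_mod_cast n.succ_ne_zero
  have h2 : (n.factorial : ℂ) ≠ 0 := by exact_mod_cast n.factorial_ne_zero
  push_cast
  field_simp

theorem taylorCoeff_id_mul_zero (f : ℂ → ℂ) : taylorCoeff (fun z => z * f z) 0 = 0 := by
  simp [taylorCoeff_zero]

/-- Induction through `(z f)' = f + z f'`: the next coefficient of `z f` is read off from its
derivative, with the induction hypothesis applied to `f'`. -/
theorem taylorCoeff_id_mul_succ {f : ℂ → ℂ} (hf : AnalyticAt ℂ f 0) (n : ℕ) :
    taylorCoeff (fun z => z * f z) (n + 1) = taylorCoeff f n := by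
  induction n generalizing f with
  | zero =>
    rw [← zero_add 1]
    have := taylorCoeff_deriv (fun z => z * f z) 0
    have h : HasDerivAt (fun z => z * f z) (1 * f 0 + 0 * deriv f 0) 0 :=
      (hasDerivAt_id (0 : ℂ)).mul hf.differentiableAt.hasDerivAt
    rw [taylorCoeff_zero, h.deriv] at this
    simpa [taylorCoeff_zero] using this.symm
  | succ n ih =>
    have e : deriv (fun z => z * f z) =ᶠ[𝓝 0] fun z => f z + z * deriv f z := by
      filter_upwards [hf.eventually_analyticAt] with z hz
      have h : HasDerivAt (fun z => z * f z) (1 * f z + z * deriv f z) z :=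
        (hasDerivAt_id z).mul hz.differentiableAt.hasDerivAt
      rw [h.deriv, one_mul]
    have h1 := taylorCoeff_deriv (fun z => z * f z) (n + 1)
    rw [taylorCoeff_congr e, taylorCoeff_add (g := fun z => z * deriv f z) hf (analyticAt_id.mul hf.deriv),
      ih hf.deriv,
      taylorCoeff_deriv] at h1
    have h2 : ((n + 1 : ℕ) : ℂ) + 1 ≠ 0 := by exact_mod_cast (n + 1).succ_ne_zero
    apply mul_left_cancel₀ h2
    rw [← h1]
    push_cast
    ring

theorem hasSum_taylorCoeff {f : ℂ → ℂ} {r : ℝ} (hf : DifferentiableOn ℂ f (Metric.ball 0 r)) {z : ℂ}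
    (hz : z ∈ Metric.ball (0 : ℂ) r) : HasSum (fun n => taylorCoeff f n * z ^ n) (f z) := by
  have h := Complex.hasSum_taylorSeries_on_ball hf hz
  have e : ∀ n : ℕ, (n.factorial : ℂ)⁻¹ • (z - 0) ^ n • iteratedDeriv n f 0
      = taylorCoeff f n * z ^ n := fun n => by
    rw [taylorCoeff, smul_eq_mul, smul_eq_mul, sub_zero, div_eq_mul_inv]
    ring
  simpa only [e] using h

theorem eqOn_ball_of_taylorCoeff_eq {f g : ℂ → ℂ} {r : ℝ}
    (hf : DifferentiableOn ℂ f (Metric.ball 0 r)) (hg : DifferentiableOn ℂ g (Metric.ball 0 r))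
    (h : ∀ n, taylorCoeff f n = taylorCoeff g n) : Set.EqOn f g (Metric.ball 0 r) := fun z hz => by
  have h1 := hasSum_taylorCoeff hf hz
  simp only [h] at h1
  exact h1.unique (hasSum_taylorCoeff hg hz)

theorem eventuallyEq_of_taylorCoeff_eq {f g : ℂ → ℂ} (hf : AnalyticAt ℂ f 0)
    (hg : AnalyticAt ℂ g 0) (h : ∀ n, taylorCoeff f n = taylorCoeff g n) : f =ᶠ[𝓝 0] g := by
  obtain ⟨r, hr, hr'⟩ := Metric.eventually_nhds_iff_ball.1
    (hf.eventually_analyticAt.and hg.eventually_analyticAt)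
  exact eventually_of_mem (Metric.ball_mem_nhds _ hr) (eqOn_ball_of_taylorCoeff_eq
    (fun z hz => (hr' z hz).1.differentiableAt.differentiableWithinAt)
    (fun z hz => (hr' z hz).2.differentiableAt.differentiableWithinAt) h)

/-! ### Power series with subexponential coefficients. -/

/-- A sequence grows subexponentially if it satisfies a three-term recurrence whose coefficients
have absolute values summing to `1` in the limit. -/
theorem exists_bound_of_three_term {u : ℕ → ℂ} {p q : ℕ → ℝ} (hp : ∀ n, 0 ≤ p n)
    (hq : ∀ n, 0 ≤ q n) (h : ∀ n, ‖u (n + 2)‖ ≤ p n * ‖u (n + 1)‖ + q n * ‖u n‖)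
    (hpq : Tendsto (fun n => p n + q n) atTop (𝓝 1)) {ρ : ℝ} (hρ : 1 < ρ) :
    ∃ C, ∀ n, ‖u n‖ ≤ C * ρ ^ n := by
  obtain ⟨N, hN⟩ := eventually_atTop.1 (hpq.eventually_le_const hρ)
  -- From `N` on, the two coefficients sum to at most `ρ`. The constant only has to dominate the
  -- terms of index below `N + 2`, which that range of the recurrence does not reach.
  set C := ∑ k ∈ Finset.range (N + 2), ‖u k‖
  have hC : 0 ≤ C := Finset.sum_nonneg fun _ _ => norm_nonneg _
  refine ⟨C, fun n => ?_⟩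
  induction n using Nat.strong_induction_on with
  | _ n ih =>
    by_cases hn : n < N + 2
    · calc ‖u n‖ ≤ C := Finset.single_le_sum (f := fun k => ‖u k‖) (fun _ _ => norm_nonneg _)
            (Finset.mem_range.2 hn)
        _ ≤ C * ρ ^ n := le_mul_of_one_le_right hC (one_le_pow₀ hρ.le)
    · obtain ⟨m, rfl⟩ : ∃ m, n = m + 2 := ⟨n - 2, by omega⟩
      have hm : ‖u m‖ ≤ C * ρ ^ (m + 1) := (ih m (by omega)).trans
        (mul_le_mul_of_nonneg_left (pow_le_pow_right₀ hρ.le (Nat.le_succ m)) hC)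
      calc ‖u (m + 2)‖ ≤ p m * ‖u (m + 1)‖ + q m * ‖u m‖ := h m
        _ ≤ p m * (C * ρ ^ (m + 1)) + q m * (C * ρ ^ (m + 1)) :=
            add_le_add (mul_le_mul_of_nonneg_left (ih _ (by omega)) (hp m))
              (mul_le_mul_of_nonneg_left hm (hq m))
        _ = (p m + q m) * (C * ρ ^ (m + 1)) := by ring
        _ ≤ ρ * (C * ρ ^ (m + 1)) :=
            mul_le_mul_of_nonneg_right (hN m (by omega)) (by positivity)
        _ = C * ρ ^ (m + 2) := by ring

theorem hasFPowerSeriesOnBall_of_subexponential {u : ℕ → ℂ}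
    (h : ∀ ρ : ℝ, 1 < ρ → ∃ C, ∀ n, ‖u n‖ ≤ C * ρ ^ n) :
    HasFPowerSeriesOnBall (FormalMultilinearSeries.ofScalars ℂ u).sum
      (FormalMultilinearSeries.ofScalars ℂ u) 0 1 := by
  have hr : 1 ≤ (FormalMultilinearSeries.ofScalars ℂ u).radius := by
    refine ENNReal.le_of_forall_nnreal_lt fun r hr => ?_
    have hr1 : (r : ℝ) < 1 := by exact_mod_cast hr
    rcases eq_or_ne r 0 with rfl | h0
    · simp
    have h0' : 0 < (r : ℝ) := by positivity
    -- For radius `r < 1` the growth hypothesis is used with `ρ = 1/r`, so `‖u n‖ r ^ n` stays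
    -- bounded.
    obtain ⟨C, hC⟩ := h (r : ℝ)⁻¹ ((one_lt_inv₀ h0').2 hr1)
    refine FormalMultilinearSeries.le_radius_of_bound _ C fun n => ?_
    rw [FormalMultilinearSeries.ofScalars_norm]
    calc ‖u n‖ * (r : ℝ) ^ n ≤ C * ((r : ℝ)⁻¹) ^ n * (r : ℝ) ^ n :=
          mul_le_mul_of_nonneg_right (hC n) (by positivity)
      _ = C := by rw [mul_assoc, ← mul_pow, inv_mul_cancel₀ h0'.ne', one_pow, mul_one]
  exact ((FormalMultilinearSeries.ofScalars ℂ u).hasFPowerSeriesOnBall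
    (lt_of_lt_of_le one_pos hr)).mono one_pos hr

theorem differentiableOn_of_subexponential {u : ℕ → ℂ}
    (h : ∀ ρ : ℝ, 1 < ρ → ∃ C, ∀ n, ‖u n‖ ≤ C * ρ ^ n) :
    DifferentiableOn ℂ (FormalMultilinearSeries.ofScalars ℂ u).sum (Metric.ball (0 : ℂ) 1) := by
  have := (hasFPowerSeriesOnBall_of_subexponential h).differentiableOn
  rwa [← ENNReal.ofReal_one, Metric.eball_ofReal] at this

theorem taylorCoeff_of_subexponential {u : ℕ → ℂ}
    (h : ∀ ρ : ℝ, 1 < ρ → ∃ C, ∀ n, ‖u n‖ ≤ C * ρ ^ n) (n : ℕ) :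
    taylorCoeff (FormalMultilinearSeries.ofScalars ℂ u).sum n = u n := by
  have h1 := (hasFPowerSeriesOnBall_of_subexponential h).hasFPowerSeriesAt
  have h2 := h1.analyticAt.hasFPowerSeriesAt
  have := congrArg (fun p => FormalMultilinearSeries.coeff p n) (h2.eq_formalMultilinearSeries h1)
  simpa [FormalMultilinearSeries.coeff_ofScalars, taylorCoeff] using this

/-! ### The hypergeometric operator and its power series solution. -/

/-- The hypergeometric differential operator
`z (1 - z) f'' + (c - (a + b + 1) z) f' - a b f`. -/
def hyperOp (a b c : ℂ) (f : ℂ → ℂ) (z : ℂ) : ℂ :=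
  z * (1 - z) * deriv (deriv f) z + (c - (a + b + 1) * z) * deriv f z - a * b * f z

theorem taylorCoeff_id_mul_deriv {f : ℂ → ℂ} (hf : AnalyticAt ℂ f 0) (n : ℕ) :
    taylorCoeff (fun z => z * deriv f z) n = n * taylorCoeff f n := by
  cases n with
  | zero => simp [taylorCoeff_id_mul_zero]
  | succ n =>
    rw [taylorCoeff_id_mul_succ hf.deriv, taylorCoeff_deriv]
    push_cast
    rfl

theorem taylorCoeff_id_mul_deriv_deriv {f : ℂ → ℂ} (hf : AnalyticAt ℂ f 0) (n : ℕ) :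
    taylorCoeff (fun z => z * deriv (deriv f) z) n = n * (n + 1) * taylorCoeff f (n + 1) := by
  rw [taylorCoeff_id_mul_deriv hf.deriv, taylorCoeff_deriv]
  ring

theorem taylorCoeff_sq_mul_deriv_deriv {f : ℂ → ℂ} (hf : AnalyticAt ℂ f 0) (n : ℕ) :
    taylorCoeff (fun z => z * (z * deriv (deriv f) z)) n = n * (n - 1) * taylorCoeff f n := by
  cases n with
  | zero => simp [taylorCoeff_id_mul_zero]
  | succ n =>
    rw [taylorCoeff_id_mul_succ (f := fun z => z * deriv (deriv f) z)
      (analyticAt_id.mul hf.deriv.deriv), taylorCoeff_id_mul_deriv_deriv hf]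
    push_cast
    ring

/-- Each term of the operator either preserves degree or lowers it by one, so only two neighbouring
coefficients occur, and their factors split into the exponents at `0` and at infinity. -/
theorem taylorCoeff_hyperOp (a b c : ℂ) {f : ℂ → ℂ} (hf : AnalyticAt ℂ f 0) (n : ℕ) :
    taylorCoeff (hyperOp a b c f) n
      = (n + 1) * (n + c) * taylorCoeff f (n + 1) - (n + a) * (n + b) * taylorCoeff f n := by
  have e : hyperOp a b c f = fun z => (z * deriv (deriv f) z
      + ((-1) * (z * (z * deriv (deriv f) z)) + (c * deriv f z
      + ((-(a + b + 1)) * (z * deriv f z) + (-(a * b)) * f z)))) := by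
    funext z
    rw [hyperOp]
    ring
  have h1 := hf.deriv
  have h2 := h1.deriv
  rw [e, taylorCoeff_add (f := fun z => z * deriv (deriv f) z) (by fun_prop) (by fun_prop),
    taylorCoeff_add (f := fun z => (-1) * (z * (z * deriv (deriv f) z))) (by fun_prop)
      (by fun_prop),
    taylorCoeff_add (f := fun z => c * deriv f z) (by fun_prop) (by fun_prop),
    taylorCoeff_add (f := fun z => (-(a + b + 1)) * (z * deriv f z)) (by fun_prop) (by fun_prop),
    taylorCoeff_const_mul, taylorCoeff_const_mul, taylorCoeff_const_mul, taylorCoeff_const_mul,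
    taylorCoeff_id_mul_deriv_deriv hf, taylorCoeff_sq_mul_deriv_deriv hf,
    taylorCoeff_id_mul_deriv hf, taylorCoeff_deriv]
  ring

theorem analyticAt_hyperOp (a b c : ℂ) {f : ℂ → ℂ} {z : ℂ} (hf : AnalyticAt ℂ f z) :
    AnalyticAt ℂ (hyperOp a b c f) z := by
  have h1 := hf.deriv
  have h2 := h1.deriv
  unfold hyperOp
  fun_prop

theorem taylorCoeff_succ_of_hyperOp_eq_zero {a b c : ℂ} {f : ℂ → ℂ} (hf : AnalyticAt ℂ f 0)
    (h : ∀ᶠ z in 𝓝 0, hyperOp a b c f z = 0) (n : ℕ) :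
    (n + 1) * (n + c) * taylorCoeff f (n + 1) = (n + a) * (n + b) * taylorCoeff f n := by
  have h1 := taylorCoeff_hyperOp a b c hf n
  have h2 : taylorCoeff (hyperOp a b c f) n = 0 := by
    rw [taylorCoeff_congr (g := fun _ => 0 * (0 : ℂ)) (h.mono fun z hz => by simpa using hz),
      taylorCoeff_const_mul, zero_mul]
  rw [h2] at h1
  linear_combination -h1

/-- Solutions of the hypergeometric equation that are analytic at `0` are determined by their
value there. -/
theorem eventuallyEq_of_hyperOp_eq_zero {a b c : ℂ} (hc : ∀ n : ℕ, (n : ℂ) + c ≠ 0) {f g : ℂ → ℂ}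
    (hf : AnalyticAt ℂ f 0) (hg : AnalyticAt ℂ g 0) (hf0 : ∀ᶠ z in 𝓝 0, hyperOp a b c f z = 0)
    (hg0 : ∀ᶠ z in 𝓝 0, hyperOp a b c g z = 0) (h : f 0 = g 0) : f =ᶠ[𝓝 0] g := by
  refine eventuallyEq_of_taylorCoeff_eq hf hg fun n => ?_
  induction n with
  | zero => rwa [taylorCoeff_zero, taylorCoeff_zero]
  | succ n ih =>
    have h1 := taylorCoeff_succ_of_hyperOp_eq_zero hf hf0 n
    rw [ih, ← taylorCoeff_succ_of_hyperOp_eq_zero hg hg0 n] at h1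
    exact mul_left_cancel₀ (mul_ne_zero (by exact_mod_cast n.succ_ne_zero) (hc n)) h1

theorem tendsto_natCast_add_div_add (p q : ℂ) :
    Tendsto (fun n : ℕ => ((n : ℂ) + p) / (n + q)) atTop (𝓝 1) := by
  have := tendsto_add_mul_div_add_mul_atTop_nhds p q (1 : ℂ) one_ne_zero
  simpa [add_comm] using this

theorem tendsto_inv_natCast_add (q : ℂ) : Tendsto (fun n : ℕ => ((n : ℂ) + q)⁻¹) atTop (𝓝 0) :=
  tendsto_inv₀_cobounded.comp ((tendsto_add_const_cobounded q).comp
    tendsto_natCast_atTop_cobounded)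

theorem ordinaryHypergeometricCoefficient_succ {a b c : ℂ} (hc : ∀ n : ℕ, (n : ℂ) + c ≠ 0) (n : ℕ) :
    (n + 1) * (n + c) * ordinaryHypergeometricCoefficient a b c (n + 1)
      = (n + a) * (n + b) * ordinaryHypergeometricCoefficient a b c n := by
  have h1 : (n : ℂ) + 1 ≠ 0 := by exact_mod_cast n.succ_ne_zero
  have h2 : c + (n : ℂ) ≠ 0 := by rw [add_comm]; exact hc n
  have h3 : (n.factorial : ℂ) ≠ 0 := by exact_mod_cast n.factorial_ne_zero
  have h4 : (ascPochhammer ℂ n).eval c ≠ 0 := by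
    rw [Ne, ascPochhammer_eval_eq_zero_iff]
    rintro ⟨k, -, hk⟩
    exact hc k (by rw [hk]; ring)
  simp only [ordinaryHypergeometricCoefficient, ascPochhammer_succ_eval, Nat.factorial_succ]
  push_cast
  field_simp
  ring

theorem ordinaryHypergeometricCoefficient_bound {a b c : ℂ} (hc : ∀ n : ℕ, (n : ℂ) + c ≠ 0) {ρ : ℝ}
    (hρ : 1 < ρ) : ∃ C, ∀ n, ‖ordinaryHypergeometricCoefficient a b c n‖ ≤ C * ρ ^ n := by
  -- A two-term recurrence is the case `q = 0`. It is used from index `n + 1` to `n + 2`, hence the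
  -- parameters raised by one; the ratio tends to `1`.
  refine exists_bound_of_three_term (q := fun _ => 0)
    (p := fun n => ‖(((n : ℂ) + (1 + a)) / (n + 2)) * ((n + (1 + b)) / (n + (1 + c)))‖)
    (fun _ => norm_nonneg _) (fun _ => le_rfl) (fun n => ?_) ?_ hρ
  · have h := ordinaryHypergeometricCoefficient_succ (a := a) (b := b) hc (n + 1)
    have h1 : (n : ℂ) + 2 ≠ 0 := by exact_mod_cast (n + 1).succ_ne_zero
    have h2 : (n : ℂ) + (1 + c) ≠ 0 := by
      have := hc (n + 1)
      push_cast at this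
      rwa [add_assoc] at this
    rw [zero_mul, add_zero, ← norm_mul]
    apply le_of_eq
    congr 1
    push_cast at h
    field_simp
    linear_combination h
  · have := ((tendsto_natCast_add_div_add (1 + a) 2).mul
      (tendsto_natCast_add_div_add (1 + b) (1 + c))).norm
    simpa using this

theorem differentiableOn_ordinaryHypergeometric {a b c : ℂ} (hc : ∀ n : ℕ, (n : ℂ) + c ≠ 0) :
    DifferentiableOn ℂ (ordinaryHypergeometric a b c : ℂ → ℂ) (Metric.ball 0 1) :=
  differentiableOn_of_subexponential fun _ => ordinaryHypergeometricCoefficient_bound hc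

theorem taylorCoeff_ordinaryHypergeometric {a b c : ℂ} (hc : ∀ n : ℕ, (n : ℂ) + c ≠ 0) (n : ℕ) :
    taylorCoeff (ordinaryHypergeometric a b c) n = ordinaryHypergeometricCoefficient a b c n :=
  taylorCoeff_of_subexponential (fun _ => ordinaryHypergeometricCoefficient_bound hc) n

theorem analyticAt_ordinaryHypergeometric {a b c : ℂ} (hc : ∀ n : ℕ, (n : ℂ) + c ≠ 0) :
    AnalyticAt ℂ (ordinaryHypergeometric a b c : ℂ → ℂ) 0 :=
  (differentiableOn_ordinaryHypergeometric hc).analyticAt (Metric.ball_mem_nhds _ one_pos)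

theorem hyperOp_ordinaryHypergeometric {a b c : ℂ} (hc : ∀ n : ℕ, (n : ℂ) + c ≠ 0) :
    ∀ᶠ z in 𝓝 0, hyperOp a b c (ordinaryHypergeometric a b c) z = 0 := by
  have hf := analyticAt_ordinaryHypergeometric (a := a) (b := b) hc
  have h := eventuallyEq_of_taylorCoeff_eq (g := fun _ => 0 * (0 : ℂ)) (analyticAt_hyperOp a b c hf)
    analyticAt_const fun n => by
      rw [taylorCoeff_hyperOp a b c hf, taylorCoeff_const_mul, zero_mul,
        taylorCoeff_ordinaryHypergeometric hc, taylorCoeff_ordinaryHypergeometric hc,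
        ordinaryHypergeometricCoefficient_succ hc, sub_self]
  exact h.mono fun z hz => by simpa using hz

/-! ### Holomorphic continuation to the cut plane through a disc coordinate. -/

theorem deriv_deriv_eq {f f' : ℂ → ℂ} {z f'' : ℂ} (h : ∀ᶠ w in 𝓝 z, HasDerivAt f (f' w) w)
    (h' : HasDerivAt f' f'' z) : deriv (deriv f) z = f'' := by
  have : deriv f =ᶠ[𝓝 z] f' := h.mono fun w hw => hw.deriv
  rw [this.deriv_eq, h'.deriv]

/-- The hypergeometric equation in the variable `w` with `z = 4 w / (1 + w) ^ 2`. -/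
theorem disc_equation {a b c : ℂ} {f : ℂ → ℂ} (hf : AnalyticAt ℂ f 0)
    (h : ∀ᶠ z in 𝓝 0, hyperOp a b c f z = 0) :
    ∀ᶠ w in 𝓝 0, (1 - w ^ 2) * w * deriv (deriv fun w => (1 + w) ^ (-2 * a) * f (4 * w / (1 + w) ^ 2)) w
      + (c + (2 * c - 4 * b) * w + (c - 2 - 4 * a) * w ^ 2)
        * deriv (fun w => (1 + w) ^ (-2 * a) * f (4 * w / (1 + w) ^ 2)) w
      + 2 * a * ((c - 2 * b) + (c - 1 - 2 * a) * w)
        * ((1 + w) ^ (-2 * a) * f (4 * w / (1 + w) ^ 2)) = 0 := by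
  have hZ : Tendsto (fun w : ℂ => 4 * w / (1 + w) ^ 2) (𝓝 0) (𝓝 0) := by
    have : ContinuousAt (fun w : ℂ => 4 * w / (1 + w) ^ 2) 0 := by
      apply ContinuousAt.div <;> first | fun_prop | simp
    simpa [ContinuousAt] using this
  have hs : ∀ᶠ w : ℂ in 𝓝 0, 1 + w ∈ Complex.slitPlane := by
    have : ContinuousAt (fun w : ℂ => 1 + w) 0 := by fun_prop
    exact this.eventually_mem (Complex.isOpen_slitPlane.mem_nhds (by simp))
  have hall := (hs.and (hZ.eventually (hf.eventually_analyticAt.and h)))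
  have hφ : ∀ w : ℂ, 1 + w ∈ Complex.slitPlane → HasDerivAt (fun w : ℂ => (1 + w) ^ (-2 * a))
      (-2 * a / (1 + w) * (1 + w) ^ (-2 * a)) w := fun w hw => by
    have h0 := Complex.slitPlane_ne_zero hw
    have := ((hasDerivAt_id w).const_add 1).cpow_const (c := -2 * a) hw
    refine this.congr_deriv ?_
    simp only [id]
    rw [Complex.cpow_sub _ _ h0, Complex.cpow_one]
    field_simp
  have hZ' : ∀ w : ℂ, 1 + w ≠ 0 → HasDerivAt (fun w : ℂ => 4 * w / (1 + w) ^ 2)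
      (4 * (1 - w) / (1 + w) ^ 3) w := fun w h0 => by
    have := ((hasDerivAt_id w).const_mul 4).div (((hasDerivAt_id w).const_add 1).pow 2)
      (pow_ne_zero 2 h0)
    refine this.congr_deriv ?_
    simp only [id, Pi.pow_apply]
    field_simp
    norm_num
    ring
  have hZ'' : ∀ w : ℂ, 1 + w ≠ 0 → HasDerivAt (fun w : ℂ => 4 * (1 - w) / (1 + w) ^ 3)
      ((8 * w - 16) / (1 + w) ^ 4) w := fun w h0 => by
    have := (((hasDerivAt_id w).const_sub 1).const_mul 4).div
      (((hasDerivAt_id w).const_add 1).pow 3) (pow_ne_zero 3 h0)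
    refine this.congr_deriv ?_
    simp only [id, Pi.pow_apply]
    field_simp
    norm_num
    ring
  have hI : ∀ w : ℂ, 1 + w ≠ 0 → HasDerivAt (fun w : ℂ => -2 * a / (1 + w))
      (2 * a / (1 + w) ^ 2) w := fun w h0 => by
    have := (hasDerivAt_const w (-2 * a)).div ((hasDerivAt_id w).const_add 1) h0
    refine this.congr_deriv ?_
    simp
  have h1 : ∀ w : ℂ, 1 + w ∈ Complex.slitPlane → AnalyticAt ℂ f (4 * w / (1 + w) ^ 2) →
      HasDerivAt (fun w => (1 + w) ^ (-2 * a) * f (4 * w / (1 + w) ^ 2))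
        ((1 + w) ^ (-2 * a) * (-2 * a / (1 + w) * f (4 * w / (1 + w) ^ 2)
          + deriv f (4 * w / (1 + w) ^ 2) * (4 * (1 - w) / (1 + w) ^ 3))) w := fun w hw hfw => by
    have h0 := Complex.slitPlane_ne_zero hw
    have := (hφ w hw).mul (HasDerivAt.comp w hfw.differentiableAt.hasDerivAt (hZ' w h0))
    refine this.congr_deriv ?_
    simp only [Function.comp]
    ring
  filter_upwards [hall.eventually_nhds] with w hw
  obtain ⟨hws, hfw, hop⟩ := hw.self_of_nhds
  have h0 := Complex.slitPlane_ne_zero hws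
  have k0 : HasDerivAt (fun w => f (4 * w / (1 + w) ^ 2))
      (deriv f (4 * w / (1 + w) ^ 2) * (4 * (1 - w) / (1 + w) ^ 3)) w :=
    HasDerivAt.comp w hfw.differentiableAt.hasDerivAt (hZ' w h0)
  have k1 : HasDerivAt (fun w => deriv f (4 * w / (1 + w) ^ 2))
      (deriv (deriv f) (4 * w / (1 + w) ^ 2) * (4 * (1 - w) / (1 + w) ^ 3)) w :=
    HasDerivAt.comp (h₂ := deriv f) w hfw.deriv.differentiableAt.hasDerivAt (hZ' w h0)
  have h2 := (hφ w hws).fun_mul (((hI w h0).fun_mul k0).fun_add (k1.fun_mul (hZ'' w h0)))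
  rw [deriv_deriv_eq (hw.mono fun w hw => h1 w hw.1 hw.2.1) h2, (h1 w hws hfw).deriv]
  rw [hyperOp] at hop
  generalize f (4 * w / (1 + w) ^ 2) = y0 at *
  generalize deriv f (4 * w / (1 + w) ^ 2) = y1 at *
  generalize deriv (deriv f) (4 * w / (1 + w) ^ 2) = y2 at *
  generalize (1 + w) ^ (-2 * a) = φ at *
  -- The transformed equation is the original one at `4w/(1+w)²` multiplied by `φ · 4(1-w)/(1+w)`.
  have e : (4 * w / (1 + w) ^ 2 * (1 - 4 * w / (1 + w) ^ 2) * y2 + (c - (a + b + 1) * (4 * w / (1 + w) ^ 2)) * y1 - a * b * y0)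
     * (φ * (4 * (1 - w) / (1 + w))) = 0 := by rw [hop, zero_mul]
  rw [← e]
  field_simp
  ring

theorem taylorCoeff_of_disc_equation {a b c : ℂ} {v : ℂ → ℂ} (hv : AnalyticAt ℂ v 0)
    (h : ∀ᶠ w in 𝓝 0, (1 - w ^ 2) * w * deriv (deriv v) w
      + (c + (2 * c - 4 * b) * w + (c - 2 - 4 * a) * w ^ 2) * deriv v w
      + 2 * a * ((c - 2 * b) + (c - 1 - 2 * a) * w) * v w = 0) (n : ℕ) :
    (n + 2) * (n + (1 + c)) * taylorCoeff v (n + 2)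
      = -2 * (c - 2 * b) * (n + (1 + a)) * taylorCoeff v (n + 1)
        + (n + 2 * a) * (n + (2 * a - c + 1)) * taylorCoeff v n := by
  have h1 := hv.deriv
  have h2 := h1.deriv
  have e : (fun w => w * deriv (deriv v) w + ((-1) * (w * (w * (w * deriv (deriv v) w)))
      + (c * deriv v w + ((2 * c - 4 * b) * (w * deriv v w)
      + ((c - 2 - 4 * a) * (w * (w * deriv v w))
      + ((2 * a * (c - 2 * b)) * v w + (2 * a * (c - 1 - 2 * a)) * (w * v w)))))))
      =ᶠ[𝓝 0] fun _ => 0 * (0 : ℂ) := by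
    filter_upwards [h] with w hw
    linear_combination hw
  -- Comparing order `n + 1` keeps all index shifts nonnegative; order `0` is not needed for the
  -- growth bound.
  have h3 := congrFun (taylorCoeff_congr e) (n + 1)
  rw [taylorCoeff_add (f := fun w => w * deriv (deriv v) w) (by fun_prop) (by fun_prop),
    taylorCoeff_add (f := fun w => (-1) * (w * (w * (w * deriv (deriv v) w)))) (by fun_prop)
      (by fun_prop),
    taylorCoeff_add (f := fun w => c * deriv v w) (by fun_prop) (by fun_prop),
    taylorCoeff_add (f := fun w => (2 * c - 4 * b) * (w * deriv v w)) (by fun_prop) (by fun_prop),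
    taylorCoeff_add (f := fun w => (c - 2 - 4 * a) * (w * (w * deriv v w))) (by fun_prop)
      (by fun_prop),
    taylorCoeff_add (f := fun w => (2 * a * (c - 2 * b)) * v w) (by fun_prop) (by fun_prop)] at h3
  simp only [taylorCoeff_const_mul] at h3
  rw [taylorCoeff_id_mul_succ (f := fun w => w * (w * deriv (deriv v) w)) (by fun_prop),
    taylorCoeff_id_mul_succ (f := fun w => w * deriv v w) (by fun_prop),
    taylorCoeff_id_mul_succ hv, taylorCoeff_id_mul_deriv_deriv hv,
    taylorCoeff_sq_mul_deriv_deriv hv, taylorCoeff_id_mul_deriv hv, taylorCoeff_id_mul_deriv hv,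
    taylorCoeff_deriv] at h3
  push_cast at h3
  linear_combination h3

/-- After division by `(n + 2)(n + 1 + c)` the middle coefficient of the recurrence is `O(1/n)` and
the last one tends to `1`. This reflects that the nonzero finite singular points `w = ±1` lie on the
unit circle. -/
theorem taylorCoeff_bound_of_disc_equation {a b c : ℂ} (hc : ∀ n : ℕ, (n : ℂ) + c ≠ 0) {v : ℂ → ℂ}
    (hv : AnalyticAt ℂ v 0)
    (h : ∀ᶠ w in 𝓝 0, (1 - w ^ 2) * w * deriv (deriv v) w
      + (c + (2 * c - 4 * b) * w + (c - 2 - 4 * a) * w ^ 2) * deriv v w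
      + 2 * a * ((c - 2 * b) + (c - 1 - 2 * a) * w) * v w = 0) {ρ : ℝ} (hρ : 1 < ρ) :
    ∃ C, ∀ n, ‖taylorCoeff v n‖ ≤ C * ρ ^ n := by
  refine exists_bound_of_three_term
    (p := fun n => ‖-2 * (c - 2 * b) * ((((n : ℂ) + (1 + a)) / (n + (1 + c))) * ((n : ℂ) + 2)⁻¹)‖)
    (q := fun n => ‖(((n : ℂ) + 2 * a) / (n + 2)) * ((n + (2 * a - c + 1)) / (n + (1 + c)))‖)
    (fun _ => norm_nonneg _) (fun _ => norm_nonneg _) (fun n => ?_) ?_ hρ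
  · have h3 := taylorCoeff_of_disc_equation hv h n
    have h1 : (n : ℂ) + 2 ≠ 0 := by exact_mod_cast (n + 1).succ_ne_zero
    have h2 : (n : ℂ) + (1 + c) ≠ 0 := by
      have := hc (n + 1)
      push_cast at this
      rwa [add_assoc] at this
    rw [← norm_mul, ← norm_mul]
    refine le_trans (le_of_eq ?_) (norm_add_le _ _)
    congr 1
    field_simp
    linear_combination h3
  · have h1 := (((tendsto_natCast_add_div_add (1 + a) (1 + c)).mul
      (tendsto_inv_natCast_add 2)).const_mul (-2 * (c - 2 * b))).norm
    have h2 := ((tendsto_natCast_add_div_add (2 * a) 2).mul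
      (tendsto_natCast_add_div_add (2 * a - c + 1) (1 + c))).norm
    simpa using h1.add h2

theorem one_sub_mem_slitPlane {z : ℂ} (hz : z ∈ cutPlane) : 1 - z ∈ Complex.slitPlane := by
  rw [Complex.mem_slitPlane_iff]
  by_contra! h
  refine hz ⟨?_, ?_⟩
  · simpa using h.2
  · have := h.1
    simp at this
    exact this

theorem mem_cutPlane_iff {z : ℂ} : z ∈ cutPlane ↔ 1 - z ∈ Complex.slitPlane := by
  refine ⟨one_sub_mem_slitPlane, fun h hz => ?_⟩
  rw [Complex.mem_slitPlane_iff] at h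
  rcases h with h | h
  · simp at h
    linarith [hz.2]
  · simp [hz.1] at h

theorem isOpen_cutPlane : IsOpen cutPlane := by
  have : cutPlane = (fun z : ℂ => 1 - z) ⁻¹' Complex.slitPlane := by
    ext z
    exact mem_cutPlane_iff
  rw [this]
  exact Complex.isOpen_slitPlane.preimage (by fun_prop)

theorem isPreconnected_cutPlane : IsPreconnected cutPlane := by
  have : cutPlane = (fun z : ℂ => 1 - z) '' Complex.slitPlane := by
    ext z
    rw [mem_cutPlane_iff]
    exact ⟨fun h => ⟨1 - z, h, by ring⟩, by rintro ⟨w, hw, rfl⟩; simpa using hw⟩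
  rw [this]
  refine IsPreconnected.image ?_ _ (by fun_prop)
  exact (Complex.starConvex_one_slitPlane.isPathConnected (by simp)).isConnected.isPreconnected

theorem ball_subset_cutPlane : Metric.ball (0 : ℂ) 1 ⊆ cutPlane := fun z hz h => by
  have h1 : z.re ≤ ‖z‖ := Complex.re_le_norm z
  rw [mem_ball_zero_iff] at hz
  linarith [h.2]

theorem zero_mem_cutPlane : (0 : ℂ) ∈ cutPlane := ball_subset_cutPlane (by simp)

theorem cpow_half_re_pos {x : ℂ} (hx : x ∈ Complex.slitPlane) : 0 < (x ^ (1 / 2 : ℂ)).re := by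
  have h0 := Complex.slitPlane_ne_zero hx
  have harg := (Complex.mem_slitPlane_iff_arg.1 hx).1
  have h1 : (Complex.log x * (1 / 2)).im = x.arg / 2 := by
    rw [Complex.mul_im]
    simp [Complex.log_im]
    ring
  rw [Complex.cpow_def_of_ne_zero h0, Complex.exp_re, h1]
  refine mul_pos (Real.exp_pos _) (Real.cos_pos_of_mem_Ioo ⟨?_, ?_⟩)
  · linarith [Complex.neg_pi_lt_arg x]
  · linarith [lt_of_le_of_ne (Complex.arg_le_pi x) harg]

theorem cpow_half_sq (x : ℂ) : (x ^ (1 / 2 : ℂ)) ^ 2 = x := by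
  rw [← Complex.cpow_nat_mul]
  norm_num

/-- The inverse of the conformal map `w ↦ 4 w / (1 + w) ^ 2` from the unit disc onto the cut
plane. -/
def discCoord (z : ℂ) : ℂ := (1 - (1 - z) ^ (1 / 2 : ℂ)) / (1 + (1 - z) ^ (1 / 2 : ℂ))

theorem one_add_ne_zero_of_re_pos {s : ℂ} (hs : 0 < s.re) : 1 + s ≠ 0 := fun h => by
  have := congrArg Complex.re h
  simp at this
  linarith

/-- `discCoord` is a Cayley transform of the principal square root of `1 - z`, which has positive
real part. -/
theorem norm_discCoord_lt {z : ℂ} (hz : z ∈ cutPlane) : ‖discCoord z‖ < 1 := by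
  have hs := cpow_half_re_pos (one_sub_mem_slitPlane hz)
  rw [discCoord, norm_div, div_lt_one (norm_pos_iff.2 (one_add_ne_zero_of_re_pos hs))]
  rw [← sq_lt_sq₀ (norm_nonneg _) (norm_nonneg _), Complex.sq_norm, Complex.sq_norm,
    Complex.normSq_apply, Complex.normSq_apply]
  simp only [Complex.sub_re, Complex.add_re, Complex.sub_im, Complex.add_im, Complex.one_re,
    Complex.one_im]
  nlinarith

theorem differentiableOn_discCoord : DifferentiableOn ℂ discCoord cutPlane := fun z hz => by
  have hs := cpow_half_re_pos (one_sub_mem_slitPlane hz)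
  have h : DifferentiableAt ℂ (fun z : ℂ => (1 - z) ^ (1 / 2 : ℂ)) z :=
    DifferentiableAt.cpow_const (by fun_prop) (one_sub_mem_slitPlane hz)
  exact ((h.const_sub 1).div (h.const_add 1)
    (one_add_ne_zero_of_re_pos hs)).differentiableWithinAt

theorem discCoord_spec {z : ℂ} (hz : z ∈ cutPlane) :
    4 * discCoord z / (1 + discCoord z) ^ 2 = z := by
  have hs := one_add_ne_zero_of_re_pos (cpow_half_re_pos (one_sub_mem_slitPlane hz))
  have h2 := cpow_half_sq (1 - z)
  have e : 1 + discCoord z = 2 / (1 + (1 - z) ^ (1 / 2 : ℂ)) := by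
    rw [discCoord]
    field_simp
    ring
  rw [e, discCoord]
  field_simp
  linear_combination -4 * h2

theorem one_add_mem_slitPlane_of_norm_lt {w : ℂ} (hw : ‖w‖ < 1) : 1 + w ∈ Complex.slitPlane := by
  rw [Complex.mem_slitPlane_iff]
  left
  have := Complex.abs_re_le_norm w
  have := neg_abs_le w.re
  simp
  linarith

/-- The point at infinity corresponds to `w = -1`, and the factor `(1 + w)^(-2a)` normalises one
exponent there to `0`; the equation in `w` then has a three-term recurrence. Its solution is
holomorphic on the whole disc, and undoing the substitution gives the continuation. -/
theorem exists_isContinuation {a b c : ℝ} (hc : ∀ n : ℕ, (n : ℂ) + (c : ℂ) ≠ 0) :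
    ∃ F, IsContinuation a b c F := by
  set f : ℂ → ℂ := ordinaryHypergeometric (a : ℂ) (b : ℂ) (c : ℂ) with hf_def
  have hf : AnalyticAt ℂ f 0 := analyticAt_ordinaryHypergeometric hc
  set v : ℂ → ℂ := fun w => (1 + w) ^ (-2 * (a : ℂ)) * f (4 * w / (1 + w) ^ 2) with hv_def
  have hv : AnalyticAt ℂ v 0 := by
    refine AnalyticAt.mul (AnalyticAt.cpow (by fun_prop) (by fun_prop) (by simp)) ?_
    refine AnalyticAt.fun_comp (by simpa using hf) ?_
    exact AnalyticAt.div (by fun_prop) (by fun_prop) (by simp)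
  have hb := fun ρ hρ => taylorCoeff_bound_of_disc_equation (ρ := ρ) hc hv
    (disc_equation hf (hyperOp_ordinaryHypergeometric hc)) hρ
  -- `v` is understood only near `0`; `V` is its Taylor series, which converges on the whole unit
  -- disc.
  set V := (FormalMultilinearSeries.ofScalars ℂ (taylorCoeff v)).sum
  have hV : DifferentiableOn ℂ V (Metric.ball 0 1) := differentiableOn_of_subexponential hb
  have hVv : V =ᶠ[𝓝 0] v := eventuallyEq_of_taylorCoeff_eq
    (hV.analyticAt (Metric.ball_mem_nhds _ one_pos)) hv (taylorCoeff_of_subexponential hb)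
  have hd : DifferentiableOn ℂ (fun z => (1 + discCoord z) ^ (2 * (a : ℂ)) * V (discCoord z))
      cutPlane := by
    refine DifferentiableOn.mul (DifferentiableOn.cpow_const
      (differentiableOn_discCoord.const_add 1)
      fun z hz => one_add_mem_slitPlane_of_norm_lt (norm_discCoord_lt hz)) ?_
    exact hV.comp differentiableOn_discCoord fun z hz => by
      simpa using norm_discCoord_lt hz
  refine ⟨_, hd, fun z hz => ?_⟩
  have hlim : Tendsto discCoord (𝓝 0) (𝓝 0) := by
    have := (differentiableOn_discCoord.differentiableAt
      (isOpen_cutPlane.mem_nhds zero_mem_cutPlane)).continuousAt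
    have h0 : discCoord 0 = 0 := by simp [discCoord]
    rwa [ContinuousAt, h0] at this
  refine AnalyticOnNhd.eqOn_of_preconnected_of_eventuallyEq (U := Metric.ball (0 : ℂ) 1)
    ((hd.mono ball_subset_cutPlane).analyticOnNhd Metric.isOpen_ball)
    ((differentiableOn_ordinaryHypergeometric hc).analyticOnNhd Metric.isOpen_ball)
    (convex_ball _ _).isPreconnected (Metric.mem_ball_self one_pos) ?_ (by simpa using hz)
  filter_upwards [hlim.eventually hVv, isOpen_cutPlane.mem_nhds zero_mem_cutPlane] with z hz hzc
  have h0 := Complex.slitPlane_ne_zero (one_add_mem_slitPlane_of_norm_lt (norm_discCoord_lt hzc))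
  rw [hz, hv_def]
  simp only
  rw [discCoord_spec hzc, ← mul_assoc, ← Complex.cpow_add _ _ h0]
  simp [hf_def]

theorem natCast_add_ne_zero {c : ℝ} (hc : ∀ n : ℤ, c ≠ n) (n : ℕ) : (n : ℂ) + (c : ℂ) ≠ 0 := by
  intro h
  refine hc (-n) ?_
  have : (n : ℝ) + c = 0 := by exact_mod_cast h
  push_cast
  linarith

theorem isContinuation_gauss2F1 (a b : ℝ) {c : ℝ} (hc : ∀ n : ℤ, c ≠ n) :
    IsContinuation a b c (gauss2F1 a b c) := by
  have h : ∃ F, IsContinuation a b c F := exists_isContinuation (natCast_add_ne_zero hc)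
  have e : gauss2F1 a b c = h.choose := by
    funext z
    rw [gauss2F1, dif_pos h]
  rw [e]
  exact h.choose_spec

/-! ### Holomorphic solutions, transformations and Wronskians. -/

/-- `f` is a holomorphic solution on `Ω` of the hypergeometric equation. -/
structure IsHyperSol (a b c : ℂ) (f : ℂ → ℂ) (Ω : Set ℂ) : Prop where
  differentiableOn : DifferentiableOn ℂ f Ω
  hyperOp_eq_zero : ∀ z ∈ Ω, hyperOp a b c f z = 0

theorem IsHyperSol.mono {a b c : ℂ} {f : ℂ → ℂ} {Ω Ω' : Set ℂ} (h : IsHyperSol a b c f Ω)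
    (hs : Ω' ⊆ Ω) : IsHyperSol a b c f Ω' :=
  ⟨h.differentiableOn.mono hs, fun z hz => h.hyperOp_eq_zero z (hs hz)⟩

theorem IsHyperSol.analyticAt {a b c : ℂ} {f : ℂ → ℂ} {Ω : Set ℂ} (h : IsHyperSol a b c f Ω)
    (hΩ : IsOpen Ω) {z : ℂ} (hz : z ∈ Ω) : AnalyticAt ℂ f z :=
  h.differentiableOn.analyticAt (hΩ.mem_nhds hz)

theorem gauss2F1_eqOn_ball (a b : ℝ) {c : ℝ} (hc : ∀ n : ℤ, c ≠ n) :
    Set.EqOn (gauss2F1 a b c) (ordinaryHypergeometric (a : ℂ) (b : ℂ) (c : ℂ))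
      (Metric.ball 0 1) := fun z hz =>
  (isContinuation_gauss2F1 a b hc).2 z (by simpa using hz)

theorem gauss2F1_eventuallyEq (a b : ℝ) {c : ℝ} (hc : ∀ n : ℤ, c ≠ n) :
    gauss2F1 a b c =ᶠ[𝓝 0] ordinaryHypergeometric (a : ℂ) (b : ℂ) (c : ℂ) :=
  eventually_of_mem (Metric.ball_mem_nhds _ one_pos) (gauss2F1_eqOn_ball a b hc)

theorem gauss2F1_zero (a b : ℝ) {c : ℝ} (hc : ∀ n : ℤ, c ≠ n) : gauss2F1 a b c 0 = 1 := by
  rw [gauss2F1_eqOn_ball a b hc (by simp), ordinaryHypergeometric_zero]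

theorem taylorCoeff_gauss2F1 (a b : ℝ) {c : ℝ} (hc : ∀ n : ℤ, c ≠ n) (n : ℕ) :
    taylorCoeff (gauss2F1 a b c) n = ordinaryHypergeometricCoefficient (a : ℂ) (b : ℂ) (c : ℂ) n := by
  rw [taylorCoeff_congr (gauss2F1_eventuallyEq a b hc),
    taylorCoeff_ordinaryHypergeometric (natCast_add_ne_zero hc)]

/-- The equation holds near `0` by the series and spreads over the connected cut plane by the
identity theorem. -/
theorem isHyperSol_gauss2F1 (a b : ℝ) {c : ℝ} (hc : ∀ n : ℤ, c ≠ n) :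
    IsHyperSol a b c (gauss2F1 a b c) cutPlane := by
  have hd := (isContinuation_gauss2F1 a b hc).1
  refine ⟨hd, ?_⟩
  have ha : AnalyticOnNhd ℂ (hyperOp a b c (gauss2F1 a b c)) cutPlane := fun z hz =>
    analyticAt_hyperOp _ _ _ (hd.analyticAt (isOpen_cutPlane.mem_nhds hz))
  refine ha.eqOn_zero_of_preconnected_of_eventuallyEq_zero isPreconnected_cutPlane
    zero_mem_cutPlane ?_
  have h1 := gauss2F1_eventuallyEq a b hc
  filter_upwards [h1, h1.deriv, h1.deriv.deriv,
    hyperOp_ordinaryHypergeometric (a := a) (b := b) (natCast_add_ne_zero hc)] with z e0 e1 e2 hz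
  rw [hyperOp] at hz
  rw [hyperOp, e0, e1, e2, hz]
  rfl

/-- `₂F₁` is the only holomorphic solution near `0` with value `1` at `0`. -/
theorem eqOn_gauss2F1 {a b c : ℝ} (hc : ∀ n : ℤ, c ≠ n) {f : ℂ → ℂ} {Ω : Set ℂ} (hΩ : IsOpen Ω)
    (hΩc : IsPreconnected Ω) (hΩs : Ω ⊆ cutPlane) (h0 : (0 : ℂ) ∈ Ω) (hf : IsHyperSol a b c f Ω)
    (hf0 : f 0 = 1) : Set.EqOn f (gauss2F1 a b c) Ω := by
  have hg := (isHyperSol_gauss2F1 a b hc).mono hΩs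
  refine AnalyticOnNhd.eqOn_of_preconnected_of_eventuallyEq (fun z hz => hf.analyticAt hΩ hz)
    (fun z hz => hg.analyticAt hΩ hz) hΩc h0 ?_
  exact eventuallyEq_of_hyperOp_eq_zero (natCast_add_ne_zero hc) (hf.analyticAt hΩ h0)
    (hg.analyticAt hΩ h0) (eventually_of_mem (hΩ.mem_nhds h0) hf.hyperOp_eq_zero)
    (eventually_of_mem (hΩ.mem_nhds h0) hg.hyperOp_eq_zero) (by rw [hf0, gauss2F1_zero a b hc])

/-- Only the logarithmic derivative of `φ` enters, so one computation serves both `z ^ (1 - c)` and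
`(-z) ^ (1 - c)`, whose cuts differ. -/
theorem hyperOp_mul_cpow {a b c : ℂ} {φ g : ℂ → ℂ} {z : ℂ} (hz : z ≠ 0)
    (hφ : ∀ᶠ w in 𝓝 z, HasDerivAt φ ((1 - c) * φ w / w) w) (hg : AnalyticAt ℂ g z) :
    hyperOp a b c (fun w => φ w * g w) z
      = φ z * hyperOp (1 + a - c) (1 + b - c) (2 - c) g z := by
  have h1 : ∀ᶠ w in 𝓝 z, HasDerivAt (fun w => φ w * g w)
      ((1 - c) * φ w / w * g w + φ w * deriv g w) w := by
    filter_upwards [hφ, hg.eventually_analyticAt] with w hw hgw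
    exact hw.fun_mul hgw.differentiableAt.hasDerivAt
  have h2 := (((hφ.self_of_nhds.const_mul (1 - c)).fun_div (hasDerivAt_id z) hz).fun_mul
    hg.differentiableAt.hasDerivAt).fun_add
    (hφ.self_of_nhds.fun_mul hg.deriv.differentiableAt.hasDerivAt)
  rw [hyperOp, hyperOp, deriv_deriv_eq h1 h2, h1.self_of_nhds.deriv]
  simp only [id]
  field_simp
  ring

theorem hyperOp_mul_one_sub_cpow {a b c : ℂ} {φ g : ℂ → ℂ} {z : ℂ} (hz : 1 - z ≠ 0)
    (hφ : ∀ᶠ w in 𝓝 z, HasDerivAt φ (-(c - a - b) * φ w / (1 - w)) w) (hg : AnalyticAt ℂ g z) :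
    hyperOp a b c (fun w => φ w * g w) z = φ z * hyperOp (c - a) (c - b) c g z := by
  have h1 : ∀ᶠ w in 𝓝 z, HasDerivAt (fun w => φ w * g w)
      (-(c - a - b) * φ w / (1 - w) * g w + φ w * deriv g w) w := by
    filter_upwards [hφ, hg.eventually_analyticAt] with w hw hgw
    exact hw.fun_mul hgw.differentiableAt.hasDerivAt
  have h2 := (((hφ.self_of_nhds.const_mul (-(c - a - b))).fun_div
    ((hasDerivAt_id z).const_sub 1) hz).fun_mul hg.differentiableAt.hasDerivAt).fun_add
    (hφ.self_of_nhds.fun_mul hg.deriv.differentiableAt.hasDerivAt)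
  rw [hyperOp, hyperOp, deriv_deriv_eq h1 h2, h1.self_of_nhds.deriv]
  simp only [id]
  field_simp
  ring

theorem hyperOp_reflect (a b c : ℂ) (f : ℂ → ℂ) (z : ℂ) :
    hyperOp a b c (fun w => f (1 - w)) z = hyperOp a b (a + b - c + 1) f (1 - z) := by
  have h1 : deriv (fun w => f (1 - w)) = fun w => -deriv f (1 - w) := by
    funext w
    rw [deriv_comp_const_sub]
  have h2 : deriv (fun w => -deriv f (1 - w)) z = deriv (deriv f) (1 - z) := by
    rw [deriv.fun_neg, deriv_comp_const_sub, neg_neg]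
  rw [hyperOp, hyperOp, h1, h2]
  ring

theorem hasDerivAt_cpow_div {p z : ℂ} (hz : z ∈ Complex.slitPlane) :
    HasDerivAt (fun w : ℂ => w ^ p) (p * z ^ p / z) z := by
  have h0 := Complex.slitPlane_ne_zero hz
  have := (hasDerivAt_id z).cpow_const (c := p) hz
  refine this.congr_deriv ?_
  simp only [id]
  rw [Complex.cpow_sub _ _ h0, Complex.cpow_one]
  field_simp

theorem hasDerivAt_neg_cpow_div {p z : ℂ} (hz : -z ∈ Complex.slitPlane) :
    HasDerivAt (fun w : ℂ => (-w) ^ p) (p * (-z) ^ p / z) z := by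
  have := HasDerivAt.comp z (hasDerivAt_cpow_div (p := p) hz) (hasDerivAt_neg z)
  refine this.congr_deriv ?_
  rw [div_neg]
  ring

theorem hasDerivAt_one_sub_cpow_div {p z : ℂ} (hz : 1 - z ∈ Complex.slitPlane) :
    HasDerivAt (fun w : ℂ => (1 - w) ^ p) (-p * (1 - z) ^ p / (1 - z)) z := by
  have := HasDerivAt.comp z (hasDerivAt_cpow_div (p := p) hz) ((hasDerivAt_id z).const_sub 1)
  refine this.congr_deriv ?_
  ring

theorem isHyperSol_one_sub_cpow_mul {a b c : ℂ} {g : ℂ → ℂ} {Ω : Set ℂ} (hΩ : IsOpen Ω)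
    (hΩs : Ω ⊆ cutPlane) (hg : IsHyperSol (c - a) (c - b) c g Ω) :
    IsHyperSol a b c (fun z => (1 - z) ^ (c - a - b) * g z) Ω := by
  refine ⟨fun z hz => ?_, fun z hz => ?_⟩
  · exact ((hasDerivAt_one_sub_cpow_div (one_sub_mem_slitPlane (hΩs hz))).differentiableAt.mul
      (hg.analyticAt hΩ hz).differentiableAt).differentiableWithinAt
  · rw [hyperOp_mul_one_sub_cpow (φ := fun z => (1 - z) ^ (c - a - b))
      (Complex.slitPlane_ne_zero (one_sub_mem_slitPlane (hΩs hz))) ?_ (hg.analyticAt hΩ hz),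
      hg.hyperOp_eq_zero z hz, mul_zero]
    filter_upwards [hΩ.mem_nhds hz] with w hw
    exact hasDerivAt_one_sub_cpow_div (one_sub_mem_slitPlane (hΩs hw))

/-- Euler's transformation. -/
theorem gauss2F1_euler (a b : ℝ) {c : ℝ} (hc : ∀ n : ℤ, c ≠ n) {z : ℂ} (hz : z ∈ cutPlane) :
    gauss2F1 a b c z = (1 - z) ^ ((c : ℂ) - a - b) * gauss2F1 (c - a) (c - b) c z := by
  have h := isHyperSol_gauss2F1 (c - a) (c - b) hc
  push_cast at h
  refine (eqOn_gauss2F1 hc isOpen_cutPlane isPreconnected_cutPlane le_rfl zero_mem_cutPlane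
    (isHyperSol_one_sub_cpow_mul isOpen_cutPlane le_rfl h) ?_ hz).symm
  simp [gauss2F1_zero _ _ hc]

/-- The Wronskian of two functions. -/
def wronskian (f g : ℂ → ℂ) (z : ℂ) : ℂ := f z * deriv g z - deriv f z * g z

theorem hasDerivAt_wronskian {f g : ℂ → ℂ} {z : ℂ} (hf : AnalyticAt ℂ f z) (hg : AnalyticAt ℂ g z) :
    HasDerivAt (wronskian f g) (f z * deriv (deriv g) z - deriv (deriv f) z * g z) z := by
  have h := (hf.differentiableAt.hasDerivAt.fun_mul hg.deriv.differentiableAt.hasDerivAt).fun_sub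
    (hf.deriv.differentiableAt.hasDerivAt.fun_mul hg.differentiableAt.hasDerivAt)
  refine h.congr_deriv ?_
  ring

/-- Abel's identity, obtained as `f · Lg - g · Lf`. The first-order equation is the same for every
pair of solutions, so quotients of Wronskians are constant. -/
theorem hyperOp_wronskian {a b c : ℂ} {f g : ℂ → ℂ} {z : ℂ} (hf : hyperOp a b c f z = 0)
    (hg : hyperOp a b c g z = 0) :
    z * (1 - z) * (f z * deriv (deriv g) z - deriv (deriv f) z * g z)
      = -(c - (a + b + 1) * z) * wronskian f g z := by
  rw [hyperOp] at hf hg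
  rw [wronskian]
  linear_combination f z * hg - g z * hf

/-- Cramer's rule: the coefficients are `W(f, f₂)/W(f₁, f₂)` and `W(f₁, f)/W(f₁, f₂)`, which are
constant by Abel's identity. -/
theorem exists_eq_of_isHyperSol {a b c : ℂ} {f₁ f₂ f : ℂ → ℂ} {Ω : Set ℂ} (hΩ : IsOpen Ω)
    (hΩc : IsPreconnected Ω) (hΩp : Ω ⊆ puncturedPlane) (h₁ : IsHyperSol a b c f₁ Ω)
    (h₂ : IsHyperSol a b c f₂ Ω) (hw : ∀ z ∈ Ω, wronskian f₁ f₂ z ≠ 0)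
    (h : IsHyperSol a b c f Ω) : ∃ k₁ k₂ : ℂ, ∀ z ∈ Ω, f z = k₁ * f₁ z + k₂ * f₂ z := by
  have key : ∀ g₁ g₂ : ℂ → ℂ, IsHyperSol a b c g₁ Ω → IsHyperSol a b c g₂ Ω →
      ∃ k, ∀ z ∈ Ω, wronskian g₁ g₂ z / wronskian f₁ f₂ z = k := by
    intro g₁ g₂ hg₁ hg₂
    have hd : ∀ z ∈ Ω, HasDerivAt (fun z => wronskian g₁ g₂ z / wronskian f₁ f₂ z) 0 z := by
      intro z hz
      refine ((hasDerivAt_wronskian (hg₁.analyticAt hΩ hz) (hg₂.analyticAt hΩ hz)).fun_div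
        (hasDerivAt_wronskian (h₁.analyticAt hΩ hz) (h₂.analyticAt hΩ hz)) (hw z hz)).congr_deriv ?_
      have e1 := hyperOp_wronskian (hg₁.hyperOp_eq_zero z hz) (hg₂.hyperOp_eq_zero z hz)
      have e2 := hyperOp_wronskian (h₁.hyperOp_eq_zero z hz) (h₂.hyperOp_eq_zero z hz)
      have h0 : z ≠ 0 := fun h => hΩp hz (by simp [h])
      have h1 : 1 - z ≠ 0 := fun h => hΩp hz (by simp [(sub_eq_zero.1 h).symm])
      refine div_eq_zero_iff.2 (Or.inl (mul_left_cancel₀ (mul_ne_zero h0 h1) ?_))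
      linear_combination wronskian f₁ f₂ z * e1 - wronskian g₁ g₂ z * e2
    exact hΩ.exists_is_const_of_deriv_eq_zero hΩc
      (fun z hz => (hd z hz).differentiableAt.differentiableWithinAt) fun z hz => (hd z hz).deriv
  obtain ⟨k₁, hk₁⟩ := key f f₂ h h₂
  obtain ⟨k₂, hk₂⟩ := key f₁ f h₁ h
  refine ⟨k₁, k₂, fun z hz => ?_⟩
  rw [← hk₁ z hz, ← hk₂ z hz]
  have := hw z hz
  field_simp
  simp only [wronskian]
  ring

theorem eq_zero_of_wronskian_ne_zero {f₁ f₂ : ℂ → ℂ} {z k₁ k₂ : ℂ} (h₁ : AnalyticAt ℂ f₁ z)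
    (h₂ : AnalyticAt ℂ f₂ z) (hw : wronskian f₁ f₂ z ≠ 0)
    (h : ∀ᶠ w in 𝓝 z, k₁ * f₁ w + k₂ * f₂ w = 0) : k₁ = 0 ∧ k₂ = 0 := by
  have e0 := h.self_of_nhds
  have e1 : k₁ * deriv f₁ z + k₂ * deriv f₂ z = 0 := by
    rw [← ((h₁.differentiableAt.hasDerivAt.const_mul k₁).fun_add
      (h₂.differentiableAt.hasDerivAt.const_mul k₂)).deriv]
    have : (fun w => k₁ * f₁ w + k₂ * f₂ w) =ᶠ[𝓝 z] fun _ => 0 := h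
    rw [this.deriv_eq, deriv_const]
  rw [wronskian] at hw
  constructor
  · refine (mul_eq_zero.1 ?_).resolve_right hw
    linear_combination deriv f₂ z * e0 - f₂ z * e1
  · refine (mul_eq_zero.1 ?_).resolve_right hw
    linear_combination f₁ z * e1 - deriv f₁ z * e0

/-- The Wronskian of `F₋` and `F₊`, up to the factor `z ^ (-c)`. -/
theorem reducedWronskian_eq {a b c : ℝ} (hc : ∀ n : ℤ, c ≠ n) {z : ℂ} (hz : z ∈ cutPlane) :
    (gauss2F1 a b c z * ((1 - c) * gauss2F1 (1 + a - c) (1 + b - c) (2 - c) z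
        + z * deriv (gauss2F1 (1 + a - c) (1 + b - c) (2 - c)) z)
      - z * deriv (gauss2F1 a b c) z * gauss2F1 (1 + a - c) (1 + b - c) (2 - c) z)
      * (1 - z) ^ ((a : ℂ) + b + 1 - c) = 1 - c := by
  have hc2 : ∀ n : ℤ, 2 - c ≠ n := fun n h => hc (2 - n) (by push_cast; linarith)
  have hF := isHyperSol_gauss2F1 a b hc
  have hG := isHyperSol_gauss2F1 (1 + a - c) (1 + b - c) hc2
  set F := gauss2F1 a b c with hFd
  set G := gauss2F1 (1 + a - c) (1 + b - c) (2 - c) with hGd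
  push_cast at hG
  have hd : ∀ z ∈ cutPlane, HasDerivAt (fun z => (F z * ((1 - c) * G z + z * deriv G z)
      - z * deriv F z * G z) * (1 - z) ^ ((a : ℂ) + b + 1 - c)) 0 z := by
    intro z hz
    have f0 := (hF.analyticAt isOpen_cutPlane hz).differentiableAt.hasDerivAt
    have f1 := (hF.analyticAt isOpen_cutPlane hz).deriv.differentiableAt.hasDerivAt
    have g0 := (hG.analyticAt isOpen_cutPlane hz).differentiableAt.hasDerivAt
    have g1 := (hG.analyticAt isOpen_cutPlane hz).deriv.differentiableAt.hasDerivAt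
    have hs := one_sub_mem_slitPlane hz
    have h1 := Complex.slitPlane_ne_zero hs
    have h := ((f0.fun_mul ((g0.const_mul (1 - (c : ℂ))).fun_add
      ((hasDerivAt_id' z).fun_mul g1))).fun_sub
      (((hasDerivAt_id' z).fun_mul f1).fun_mul g0)).fun_mul
      (hasDerivAt_one_sub_cpow_div (p := (a : ℂ) + b + 1 - c) hs)
    refine h.congr_deriv ?_
    have eF := hF.hyperOp_eq_zero z hz
    have eG := hG.hyperOp_eq_zero z hz
    rw [hyperOp] at eF eG
    -- With one factor `1 - z` split off the power, the derivative becomes `q` times a polynomial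
    -- expression, a combination of the two differential equations.
    obtain ⟨q, hq⟩ : ∃ q, (1 - z) ^ ((a : ℂ) + b + 1 - c) = q * (1 - z) :=
      ⟨_, (div_mul_cancel₀ _ h1).symm⟩
    rw [mul_div_assoc, hq, mul_div_cancel_right₀ _ h1]
    linear_combination q * F z * eG - q * G z * eF
  obtain ⟨k, hk⟩ := isOpen_cutPlane.exists_is_const_of_deriv_eq_zero isPreconnected_cutPlane
    (fun z hz => (hd z hz).differentiableAt.differentiableWithinAt) fun z hz => (hd z hz).deriv
  have h1 := hk z hz
  -- Leaving out the factor `z ^ (-c)` makes the expression regular at `0`, where the constant can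
  -- be read off as `1 - c`.
  have h0 := hk 0 zero_mem_cutPlane
  simp only [hFd, hGd, gauss2F1_zero _ _ hc, gauss2F1_zero _ _ hc2] at h0
  rw [h1, ← h0]
  simp

/-- The Wronskian is `φ / z` times the reduced one, and a power of `1 - z` turns the latter into `1
- c ≠ 0`. Any branch `φ` is allowed. -/
theorem wronskian_ne_zero {a b c : ℝ} (hc : ∀ n : ℤ, c ≠ n) {φ : ℂ → ℂ} {z : ℂ} (hz : z ∈ cutPlane)
    (h0 : z ≠ 0) (hφ : HasDerivAt φ ((1 - c) * φ z / z) z) (hφ0 : φ z ≠ 0) :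
    wronskian (gauss2F1 a b c) (fun w => φ w * gauss2F1 (1 + a - c) (1 + b - c) (2 - c) w) z ≠ 0 := by
  have hc2 : ∀ n : ℤ, 2 - c ≠ n := fun n h => hc (2 - n) (by push_cast; linarith)
  have hG := isHyperSol_gauss2F1 (1 + a - c) (1 + b - c) hc2
  have h := reducedWronskian_eq (a := a) (b := b) hc hz
  rw [wronskian,
    (hφ.fun_mul (hG.analyticAt isOpen_cutPlane hz).differentiableAt.hasDerivAt).deriv]
  intro hw
  have hc1 : (1 : ℂ) - c ≠ 0 := fun h => hc 1 (by
    have : (1 : ℝ) - c = 0 := by exact_mod_cast h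
    push_cast
    linarith)
  apply hc1
  rw [← h]
  refine mul_eq_zero_of_left (mul_left_cancel₀ hφ0 ?_) _
  field_simp at hw
  linear_combination hw

/-! ### Connection between the solutions at `0` and at `1`. -/

/-- The plane cut along `(-∞, 0]` and `[1, ∞)`. -/
def doubleCutPlane : Set ℂ := cutPlane ∩ Complex.slitPlane

theorem mem_doubleCutPlane_iff {z : ℂ} :
    z ∈ doubleCutPlane ↔ z.im ≠ 0 ∨ (0 < z.re ∧ z.re < 1) := by
  rw [doubleCutPlane, Set.mem_inter_iff, Complex.mem_slitPlane_iff, cutPlane, Set.mem_ofPred_eq]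
  by_cases h : z.im = 0
  · simp [h, and_comm]
  · simp [h]

theorem isOpen_doubleCutPlane : IsOpen doubleCutPlane :=
  isOpen_cutPlane.inter Complex.isOpen_slitPlane

theorem isPreconnected_doubleCutPlane : IsPreconnected doubleCutPlane := by
  have h : StarConvex ℝ (1 / 2 : ℂ) doubleCutPlane := by
    intro z hz s t hs ht hst
    rw [mem_doubleCutPlane_iff] at hz ⊢
    have him : (s • (1 / 2 : ℂ) + t • z).im = t * z.im := by simp
    have hre : (s • (1 / 2 : ℂ) + t • z).re = s / 2 + t * z.re := by
      simp
      ring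
    rw [him, hre]
    rcases ht.eq_or_lt with rfl | ht
    · right
      constructor <;> linarith
    · rcases hz with hz | ⟨h1, h2⟩
      · exact Or.inl (mul_ne_zero ht.ne' hz)
      · right
        constructor <;> nlinarith
  exact (h.isPathConnected (by rw [mem_doubleCutPlane_iff]; norm_num)).isConnected.isPreconnected

theorem doubleCutPlane_subset_cutPlane : doubleCutPlane ⊆ cutPlane := Set.inter_subset_left

theorem doubleCutPlane_subset_puncturedPlane : doubleCutPlane ⊆ puncturedPlane := fun z hz h => by
  rcases h with rfl | rfl
  · simp [mem_doubleCutPlane_iff] at hz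
  · simp [mem_doubleCutPlane_iff] at hz

theorem one_sub_mem_doubleCutPlane {z : ℂ} (hz : z ∈ doubleCutPlane) : 1 - z ∈ doubleCutPlane := by
  rw [mem_doubleCutPlane_iff] at hz ⊢
  rcases hz with h | ⟨h1, h2⟩
  · exact Or.inl (by simpa using h)
  · right
    simp
    exact ⟨h2, h1⟩

theorem ofReal_mem_doubleCutPlane {x : ℝ} (h0 : 0 < x) (h1 : x < 1) : (x : ℂ) ∈ doubleCutPlane := by
  rw [mem_doubleCutPlane_iff]
  simp [h0, h1]

theorem two_sub_ne_int {c : ℝ} (hc : ∀ n : ℤ, c ≠ n) (n : ℤ) : 2 - c ≠ n := fun h =>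
  hc (2 - n) (by push_cast; linarith)

theorem reflected_ne_int {a b c : ℝ} (hcab : ∀ n : ℤ, c - a - b ≠ n) (n : ℤ) :
    a + b - c + 1 ≠ n := fun h => hcab (1 - n) (by push_cast; linarith)

theorem add_nat_ne_int {c : ℝ} (hc : ∀ n : ℤ, c ≠ n) (k : ℕ) (n : ℤ) : c + k ≠ n := fun h =>
  hc (n - k) (by push_cast; linarith)

theorem gauss2F1_symm (a b : ℝ) {c : ℝ} (hc : ∀ n : ℤ, c ≠ n) {z : ℂ} (hz : z ∈ cutPlane) :
    gauss2F1 a b c z = gauss2F1 b a c z := by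
  have h := isHyperSol_gauss2F1 a b hc
  refine eqOn_gauss2F1 hc isOpen_cutPlane isPreconnected_cutPlane le_rfl zero_mem_cutPlane
    ⟨h.differentiableOn, fun w hw => ?_⟩ (gauss2F1_zero a b hc) hz
  rw [← h.hyperOp_eq_zero w hw, hyperOp, hyperOp]
  ring

theorem isHyperSol_Fminus (a b : ℝ) {c : ℝ} (hc : ∀ n : ℤ, c ≠ n) :
    IsHyperSol a b c (Fminus a b c) cutPlane :=
  isHyperSol_gauss2F1 a b hc

theorem isHyperSol_branch {a b c : ℝ} (hc : ∀ n : ℤ, c ≠ n) {φ : ℂ → ℂ} {Ω : Set ℂ}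
    (hΩ : IsOpen Ω) (hΩs : Ω ⊆ cutPlane) (hΩ0 : (0 : ℂ) ∉ Ω)
    (hφ : ∀ z ∈ Ω, HasDerivAt φ ((1 - c) * φ z / z) z) :
    IsHyperSol a b c (fun z => φ z * gauss2F1 (1 + a - c) (1 + b - c) (2 - c) z) Ω := by
  have hg := (isHyperSol_gauss2F1 (1 + a - c) (1 + b - c) (two_sub_ne_int hc)).mono hΩs
  push_cast at hg
  refine ⟨fun z hz => ?_, fun z hz => ?_⟩
  · exact ((hφ z hz).differentiableAt.mul
      (hg.analyticAt hΩ hz).differentiableAt).differentiableWithinAt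
  · rw [hyperOp_mul_cpow (fun h => hΩ0 (h ▸ hz)) ?_ (hg.analyticAt hΩ hz),
      hg.hyperOp_eq_zero z hz, mul_zero]
    exact eventually_of_mem (hΩ.mem_nhds hz) hφ

theorem zero_notMem_doubleCutPlane : (0 : ℂ) ∉ doubleCutPlane := fun h =>
  doubleCutPlane_subset_puncturedPlane h (by simp)

theorem isHyperSol_Fplus (a b : ℝ) {c : ℝ} (hc : ∀ n : ℤ, c ≠ n) :
    IsHyperSol a b c (Fplus a b c) doubleCutPlane :=
  isHyperSol_branch hc isOpen_doubleCutPlane doubleCutPlane_subset_cutPlane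
    zero_notMem_doubleCutPlane fun _ hz => hasDerivAt_cpow_div hz.2

theorem wronskian_Fminus_Fplus_ne_zero (a b : ℝ) {c : ℝ} (hc : ∀ n : ℤ, c ≠ n) {z : ℂ}
    (hz : z ∈ doubleCutPlane) : wronskian (Fminus a b c) (Fplus a b c) z ≠ 0 := by
  have h0 := Complex.slitPlane_ne_zero hz.2
  exact wronskian_ne_zero hc hz.1 h0 (hasDerivAt_cpow_div hz.2) (by simp [Complex.cpow_eq_zero_iff, h0])

theorem IsHyperSol.reflect {a b c : ℝ} {f : ℂ → ℂ} {Ω Ω' : Set ℂ}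
    (h : IsHyperSol a b (a + b - c + 1 : ℝ) f Ω) (hs : ∀ z ∈ Ω', 1 - z ∈ Ω) :
    IsHyperSol a b c (fun z => f (1 - z)) Ω' := by
  refine ⟨h.differentiableOn.comp (by fun_prop) hs, fun z hz => ?_⟩
  have := h.hyperOp_eq_zero _ (hs z hz)
  push_cast at this
  rw [hyperOp_reflect, this]

theorem wronskian_reflect (f g : ℂ → ℂ) (z : ℂ) :
    wronskian (fun w => f (1 - w)) (fun w => g (1 - w)) z = -wronskian f g (1 - z) := by
  rw [wronskian, wronskian, deriv_comp_const_sub, deriv_comp_const_sub]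
  ring

/-- `₂F₁(a, b, c, ·)` is `k₁`, `k₂` times the solutions at `1` with exponents `0`, `c - a - b`. -/
def IsConnection (a b c : ℝ) (k₁ k₂ : ℂ) : Prop :=
  ∀ z ∈ doubleCutPlane, gauss2F1 a b c z
    = k₁ * Fminus a b (a + b - c + 1) (1 - z) + k₂ * Fplus a b (a + b - c + 1) (1 - z)

/-- Under `z ↦ 1 - z` the basis at `0` for the parameter `a + b - c + 1` becomes a basis at `1` for
`c`. -/
theorem exists_isConnection {a b c : ℝ} (hc : ∀ n : ℤ, c ≠ n) (hcab : ∀ n : ℤ, c - a - b ≠ n) :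
    ∃ k₁ k₂, IsConnection a b c k₁ k₂ := by
  have hr := reflected_ne_int hcab
  exact exists_eq_of_isHyperSol isOpen_doubleCutPlane isPreconnected_doubleCutPlane
    doubleCutPlane_subset_puncturedPlane
    ((isHyperSol_Fminus a b hr).reflect fun z hz =>
      doubleCutPlane_subset_cutPlane (one_sub_mem_doubleCutPlane hz))
    ((isHyperSol_Fplus a b hr).reflect fun z hz => one_sub_mem_doubleCutPlane hz)
    (fun z hz => by
      rw [wronskian_reflect]
      exact neg_ne_zero.2 (wronskian_Fminus_Fplus_ne_zero a b hr (one_sub_mem_doubleCutPlane hz)))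
    ((isHyperSol_gauss2F1 a b hc).mono doubleCutPlane_subset_cutPlane)

theorem half_mem_doubleCutPlane : (1 / 2 : ℂ) ∈ doubleCutPlane := by
  rw [mem_doubleCutPlane_iff]
  norm_num

theorem IsConnection.unique {a b c : ℝ} (hcab : ∀ n : ℤ, c - a - b ≠ n) {k₁ k₂ l₁ l₂ : ℂ}
    (hk : IsConnection a b c k₁ k₂) (hl : IsConnection a b c l₁ l₂) : k₁ = l₁ ∧ k₂ = l₂ := by
  have hr := reflected_ne_int hcab
  have hz := half_mem_doubleCutPlane
  have h1 : IsHyperSol a b c (fun z => Fminus a b (a + b - c + 1) (1 - z)) doubleCutPlane :=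
    (isHyperSol_Fminus a b hr).reflect fun z hz =>
      doubleCutPlane_subset_cutPlane (one_sub_mem_doubleCutPlane hz)
  have h2 : IsHyperSol a b c (fun z => Fplus a b (a + b - c + 1) (1 - z)) doubleCutPlane :=
    (isHyperSol_Fplus a b hr).reflect fun z hz => one_sub_mem_doubleCutPlane hz
  have := eq_zero_of_wronskian_ne_zero (k₁ := k₁ - l₁) (k₂ := k₂ - l₂)
    (h1.analyticAt isOpen_doubleCutPlane hz) (h2.analyticAt isOpen_doubleCutPlane hz)
    (by
      rw [wronskian_reflect]
      exact neg_ne_zero.2 (wronskian_Fminus_Fplus_ne_zero a b hr (one_sub_mem_doubleCutPlane hz)))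
    (by
      filter_upwards [isOpen_doubleCutPlane.mem_nhds hz] with z hz
      linear_combination hl z hz - hk z hz)
  exact ⟨sub_eq_zero.1 this.1, sub_eq_zero.1 this.2⟩

/-! ### Contiguous relations and the shift `c ↦ c + 1`. -/

theorem eqOn_cutPlane_of_taylorCoeff_eq {f g : ℂ → ℂ} (hf : AnalyticOnNhd ℂ f cutPlane)
    (hg : AnalyticOnNhd ℂ g cutPlane) (h : ∀ n, taylorCoeff f n = taylorCoeff g n) :
    Set.EqOn f g cutPlane :=
  hf.eqOn_of_preconnected_of_eventuallyEq hg isPreconnected_cutPlane zero_mem_cutPlane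
    (eventuallyEq_of_taylorCoeff_eq (hf 0 zero_mem_cutPlane) (hg 0 zero_mem_cutPlane) h)

theorem ordinaryHypergeometricCoefficient_zero (a b c : ℂ) :
    ordinaryHypergeometricCoefficient a b c 0 = 1 := by
  simp [ordinaryHypergeometricCoefficient]

theorem ordinaryHypergeometricCoefficient_add_one {a b c : ℂ} (hc : ∀ n : ℕ, (n : ℂ) + c ≠ 0)
    (n : ℕ) : (c + n) * ordinaryHypergeometricCoefficient a b (c + 1) n
      = c * ordinaryHypergeometricCoefficient a b c n := by
  have hc1 : ∀ n : ℕ, (n : ℂ) + (c + 1) ≠ 0 := fun n h => hc (n + 1) (by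
    push_cast
    linear_combination h)
  induction n with
  | zero => simp [ordinaryHypergeometricCoefficient_zero]
  | succ n ih =>
    have h1 := ordinaryHypergeometricCoefficient_succ (a := a) (b := b) hc n
    have h2 := ordinaryHypergeometricCoefficient_succ (a := a) (b := b) hc1 n
    have h0 : (n : ℂ) + 1 ≠ 0 := by exact_mod_cast n.succ_ne_zero
    apply mul_left_cancel₀ (mul_ne_zero h0 (hc n))
    push_cast
    linear_combination (c + n) * h2 + (n + a) * (n + b) * ih - c * h1

theorem ordinaryHypergeometricCoefficient_deriv {a b c : ℂ} (hc : ∀ n : ℕ, (n : ℂ) + c ≠ 0)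
    (n : ℕ) : (n + 1) * c * ordinaryHypergeometricCoefficient a b c (n + 1)
      = a * b * ordinaryHypergeometricCoefficient (a + 1) (b + 1) (c + 1) n := by
  have hc1 : ∀ n : ℕ, (n : ℂ) + (c + 1) ≠ 0 := fun n h => hc (n + 1) (by
    push_cast
    linear_combination h)
  induction n with
  | zero =>
    have h1 := ordinaryHypergeometricCoefficient_succ (a := a) (b := b) hc 0
    rw [ordinaryHypergeometricCoefficient_zero] at h1 ⊢
    push_cast at h1 ⊢
    linear_combination h1
  | succ n ih =>
    have h1 := ordinaryHypergeometricCoefficient_succ (a := a) (b := b) hc (n + 1)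
    have h2 := ordinaryHypergeometricCoefficient_succ (a := a + 1) (b := b + 1) hc1 n
    have h0 : (n : ℂ) + 1 ≠ 0 := by exact_mod_cast n.succ_ne_zero
    apply mul_left_cancel₀ (mul_ne_zero h0 (hc1 n))
    push_cast at h1 ⊢
    linear_combination (n + 1) * c * h1 + (n + 1 + a) * (n + 1 + b) * ih - a * b * h2

theorem analyticOnNhd_gauss2F1 (a b : ℝ) {c : ℝ} (hc : ∀ n : ℤ, c ≠ n) :
    AnalyticOnNhd ℂ (gauss2F1 a b c) cutPlane := fun _ hz =>
  (isHyperSol_gauss2F1 a b hc).analyticAt isOpen_cutPlane hz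

/-- The operator `z d/dz + c` multiplies the `n`-th coefficient by `n + c`, and so lowers the third
parameter from `c + 1` to `c`. The two relations that follow describe the same operator on the basis
at `1`. -/
theorem gauss2F1_contiguous_zero (a b : ℝ) {c : ℝ} (hc : ∀ n : ℤ, c ≠ n) {z : ℂ}
    (hz : z ∈ cutPlane) :
    z * deriv (gauss2F1 a b (c + 1)) z + c * gauss2F1 a b (c + 1) z = c * gauss2F1 a b c z := by
  have hc1 : ∀ n : ℤ, c + 1 ≠ n := by exact_mod_cast add_nat_ne_int hc 1
  have hf := analyticOnNhd_gauss2F1 a b hc1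
  have hg := analyticOnNhd_gauss2F1 a b hc
  refine eqOn_cutPlane_of_taylorCoeff_eq
    (f := fun z => z * deriv (gauss2F1 a b (c + 1)) z + c * gauss2F1 a b (c + 1) z)
    (g := fun z => c * gauss2F1 a b c z) (fun w hw => ?_) (fun w hw => ?_) (fun n => ?_) hz
  · have h0 := hf w hw
    have h1 := h0.deriv
    fun_prop
  · have h0 := hg w hw
    fun_prop
  · have h0 := hf 0 zero_mem_cutPlane
    have h1 := h0.deriv
    rw [taylorCoeff_add (f := fun z => z * deriv (gauss2F1 a b (c + 1)) z) (by fun_prop)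
      (by fun_prop), taylorCoeff_const_mul, taylorCoeff_const_mul, taylorCoeff_id_mul_deriv h0,
      taylorCoeff_gauss2F1 a b hc1, taylorCoeff_gauss2F1 a b hc]
    have := ordinaryHypergeometricCoefficient_add_one (a := a) (b := b) (natCast_add_ne_zero hc) n
    push_cast
    linear_combination this

/-- With `t = 1 - z` the left side is `z d/dz + c` applied to the exponent-`0` solution at `1` for
the parameter `c + 1`. -/
theorem gauss2F1_contiguous_one {a b c : ℝ} (hcab : ∀ n : ℤ, c - a - b ≠ n) {t : ℂ}
    (ht : t ∈ cutPlane) :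
    -(1 - t) * deriv (gauss2F1 a b (a + b - c)) t + c * gauss2F1 a b (a + b - c) t
      = (c - a) * (c - b) / (c - a - b) * gauss2F1 a b (a + b - c + 1) t := by
  have hS : ∀ n : ℤ, a + b - c ≠ n := fun n h => hcab (-n) (by push_cast; linarith)
  have hS1 := reflected_ne_int hcab
  have hf := analyticOnNhd_gauss2F1 a b hS
  have hg := analyticOnNhd_gauss2F1 a b hS1
  set F := gauss2F1 a b (a + b - c) with hF
  have hs : (c : ℂ) - a - b ≠ 0 := by
    have := hcab 0
    exact_mod_cast this
  refine eqOn_cutPlane_of_taylorCoeff_eq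
    (f := fun t => -(1 - t) * deriv F t + c * F t)
    (g := fun t => (c - a) * (c - b) / (c - a - b) * gauss2F1 a b (a + b - c + 1) t)
    (fun w hw => ?_) (fun w hw => ?_) (fun n => ?_) ht
  · have h0 := hf w hw
    have h1 := h0.deriv
    fun_prop
  · have h0 := hg w hw
    fun_prop
  · have h0 := hf 0 zero_mem_cutPlane
    have h1 := h0.deriv
    have e : (fun t => -(1 - t) * deriv F t + c * F t)
        = fun t => (-1) * deriv F t + (t * deriv F t + c * F t) := by
      funext t
      ring
    rw [e, taylorCoeff_add (f := fun t => (-1) * deriv F t) (by fun_prop) (by fun_prop),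
      taylorCoeff_add (f := fun t => t * deriv F t) (by fun_prop) (by fun_prop),
      taylorCoeff_const_mul, taylorCoeff_const_mul, taylorCoeff_const_mul,
      taylorCoeff_id_mul_deriv h0, taylorCoeff_deriv, hF, taylorCoeff_gauss2F1 a b hS,
      taylorCoeff_gauss2F1 a b hS, taylorCoeff_gauss2F1 a b hS1]
    have hne := natCast_add_ne_zero hS
    have h2 := ordinaryHypergeometricCoefficient_add_one (a := a) (b := b) hne n
    have h3 := ordinaryHypergeometricCoefficient_succ (a := a) (b := b) hne n
    have hn := hne n
    push_cast at h2 h3 hn ⊢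
    apply mul_left_cancel₀ (mul_ne_zero hn hs)
    have hκ : ((c : ℂ) - a) * (c - b) / (c - a - b) * (c - a - b) = (c - a) * (c - b) :=
      div_mul_cancel₀ _ hs
    generalize ((c : ℂ) - a) * (c - b) / (c - a - b) = κ at hκ ⊢
    generalize ordinaryHypergeometricCoefficient (a : ℂ) b (a + b - c) n = u₀ at *
    generalize ordinaryHypergeometricCoefficient (a : ℂ) b (a + b - c) (n + 1) = u₁ at *
    generalize ordinaryHypergeometricCoefficient (a : ℂ) b (a + b - c + 1) n = u₂ at *
    linear_combination (-((c : ℂ) - a - b)) * h3 - (c - a) * (c - b) * h2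
      - (n + (a + b - c)) * u₂ * hκ

/-- This is `z d/dz + c` acting on `t ^ s · ₂F₁`, the other solution at `1`, after division by `t ^
(s - 1)`. It is applied with `c - b`, `c - a` for `a`, `b` and `s = c + 1 - a - b`, when `a + b + 1
- s` becomes `c`. -/
theorem gauss2F1_contiguous_two (a b : ℝ) {s : ℝ} (hs : ∀ n : ℤ, s ≠ n) {t : ℂ}
    (ht : t ∈ cutPlane) :
    -(1 - t) * (s * gauss2F1 (a + 1) (b + 1) (s + 1) t
        + t * deriv (gauss2F1 (a + 1) (b + 1) (s + 1)) t)
      + (a + b + 1 - s) * t * gauss2F1 (a + 1) (b + 1) (s + 1) t = -s * gauss2F1 a b s t := by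
  have hs1 : ∀ n : ℤ, s + 1 ≠ n := by exact_mod_cast add_nat_ne_int hs 1
  have hf := analyticOnNhd_gauss2F1 (a + 1) (b + 1) hs1
  have hg := analyticOnNhd_gauss2F1 a b hs
  set F := gauss2F1 (a + 1) (b + 1) (s + 1) with hF
  refine eqOn_cutPlane_of_taylorCoeff_eq
    (f := fun t => -(1 - t) * (s * F t + t * deriv F t) + (a + b + 1 - s) * t * F t)
    (g := fun t => -s * gauss2F1 a b s t) (fun w hw => ?_) (fun w hw => ?_) (fun n => ?_) ht
  · have h0 := hf w hw
    have h1 := h0.deriv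
    fun_prop
  · have h0 := hg w hw
    fun_prop
  · have h0 := hf 0 zero_mem_cutPlane
    have h1 := h0.deriv
    have e : (fun t => -(1 - t) * (s * F t + t * deriv F t) + (a + b + 1 - s) * t * F t)
        = fun t => (-(s : ℂ)) * F t + ((-1) * (t * deriv F t) + (t * (t * deriv F t)
          + (a + b + 1) * (t * F t))) := by
      funext t
      ring
    rw [e, taylorCoeff_add (f := fun t => (-(s : ℂ)) * F t) (by fun_prop) (by fun_prop),
      taylorCoeff_add (f := fun t => (-1) * (t * deriv F t)) (by fun_prop) (by fun_prop),
      taylorCoeff_add (f := fun t => t * (t * deriv F t)) (by fun_prop) (by fun_prop),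
      taylorCoeff_const_mul, taylorCoeff_const_mul, taylorCoeff_const_mul, taylorCoeff_const_mul,
      taylorCoeff_id_mul_deriv h0]
    cases n with
    | zero =>
      simp only [taylorCoeff_zero, hF, gauss2F1_zero _ _ hs,
        gauss2F1_zero _ _ hs1]
      simp
    | succ n =>
      rw [taylorCoeff_id_mul_succ (f := fun t => t * deriv F t) (by fun_prop),
        taylorCoeff_id_mul_succ h0, taylorCoeff_id_mul_deriv h0, hF,
        taylorCoeff_gauss2F1 _ _ hs1, taylorCoeff_gauss2F1 _ _ hs1, taylorCoeff_gauss2F1 _ _ hs]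
      have h2 := ordinaryHypergeometricCoefficient_deriv (a := a) (b := b)
        (natCast_add_ne_zero hs) n
      have h3 := ordinaryHypergeometricCoefficient_succ (a := ((a + 1 : ℝ) : ℂ))
        (b := ((b + 1 : ℝ) : ℂ)) (natCast_add_ne_zero hs1) n
      have hn : (n : ℂ) + 1 ≠ 0 := by exact_mod_cast n.succ_ne_zero
      push_cast at h2 h3 ⊢
      apply mul_left_cancel₀ hn
      linear_combination -h3 + h2

/-- Applying `z d/dz + c` to the connection formula for `c + 1` gives `c` times the one for `c`,
with coefficients rescaled according to the contiguous relations. -/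
theorem IsConnection.step {a b c : ℝ} (hc : ∀ n : ℤ, c ≠ n) (hcab : ∀ n : ℤ, c - a - b ≠ n)
    {k₁ k₂ : ℂ} (h : IsConnection a b (c + 1) k₁ k₂) :
    IsConnection a b c (k₁ * (((c - a) * (c - b) / (c * (c - a - b)) : ℝ) : ℂ))
      (k₂ * ((-(c + 1 - a - b) / c : ℝ) : ℂ)) := by
  have hS : ∀ n : ℤ, a + b - c ≠ n := fun n h => hcab (-n) (by push_cast; linarith)
  have hs : ∀ n : ℤ, c + 1 - a - b ≠ n := fun n h => hcab (n - 1) (by push_cast; linarith)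
  have hs1 : ∀ n : ℤ, c + 1 - a - b + 1 ≠ n := by exact_mod_cast add_nat_ne_int hs 1
  have hc1 : ∀ n : ℤ, c + 1 ≠ n := by exact_mod_cast add_nat_ne_int hc 1
  have hc0 : (c : ℂ) ≠ 0 := by exact_mod_cast hc 0
  have hcab0 : (c : ℂ) - a - b ≠ 0 := by exact_mod_cast hcab 0
  intro z hz
  have ht := one_sub_mem_doubleCutPlane hz
  have ht0 := Complex.slitPlane_ne_zero ht.2
  have e : ∀ w ∈ doubleCutPlane, gauss2F1 a b (c + 1) w = k₁ * gauss2F1 a b (a + b - c) (1 - w)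
      + k₂ * ((1 - w) ^ ((c : ℂ) + 1 - a - b)
        * gauss2F1 (c - b + 1) (c - a + 1) (c + 1 - a - b + 1) (1 - w)) := by
    intro w hw
    have := h w hw
    rwa [Fminus, Fplus, show a + b - (c + 1) + 1 = a + b - c by ring,
      show 1 + a - (a + b - c) = c - b + 1 by ring, show 1 + b - (a + b - c) = c - a + 1 by ring,
      show 2 - (a + b - c) = c + 1 - a - b + 1 by ring,
      show 1 - ((a + b - c : ℝ) : ℂ) = (c : ℂ) + 1 - a - b by push_cast; ring] at this
  have d1 : HasDerivAt (fun w => gauss2F1 a b (a + b - c) (1 - w))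
      (-deriv (gauss2F1 a b (a + b - c)) (1 - z)) z := by
    have := HasDerivAt.comp z (analyticOnNhd_gauss2F1 a b hS _ ht.1).differentiableAt.hasDerivAt
      ((hasDerivAt_id z).const_sub 1)
    exact this.congr_deriv (by ring)
  have d2 : HasDerivAt (fun w => gauss2F1 (c - b + 1) (c - a + 1) (c + 1 - a - b + 1) (1 - w))
      (-deriv (gauss2F1 (c - b + 1) (c - a + 1) (c + 1 - a - b + 1)) (1 - z)) z := by
    have := HasDerivAt.comp z (analyticOnNhd_gauss2F1 (c - b + 1) (c - a + 1) hs1 _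
      ht.1).differentiableAt.hasDerivAt ((hasDerivAt_id z).const_sub 1)
    exact this.congr_deriv (by ring)
  have d := (d1.const_mul k₁).fun_add (((hasDerivAt_one_sub_cpow_div
    (p := (c : ℂ) + 1 - a - b) ht.2).fun_mul d2).const_mul k₂)
  have d' := d.congr_of_eventuallyEq (eventually_of_mem (isOpen_doubleCutPlane.mem_nhds hz) e)
  have r0 := gauss2F1_contiguous_zero a b hc hz.1
  rw [d'.deriv, e z hz] at r0
  have r1 := gauss2F1_contiguous_one hcab ht.1
  have r2 := gauss2F1_contiguous_two (c - b) (c - a) hs ht.1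
  have eP : Fplus a b (a + b - c + 1) (1 - z)
      = (1 - z) ^ ((c : ℂ) + 1 - a - b) / (1 - z) * gauss2F1 (c - b) (c - a) (c + 1 - a - b) (1 - z) := by
    rw [Fplus, show 1 + a - (a + b - c + 1) = c - b by ring,
      show 1 + b - (a + b - c + 1) = c - a by ring,
      show 2 - (a + b - c + 1) = c + 1 - a - b by ring,
      show 1 - ((a + b - c + 1 : ℝ) : ℂ) = (c : ℂ) + 1 - a - b - 1 by push_cast; ring,
      Complex.cpow_sub _ _ ht0, Complex.cpow_one]
  rw [eP, Fminus]
  push_cast at r2 ⊢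
  -- `q` is `(1 - z) ^ (c - a - b)`, the power carried by the second solution at `1` for the
  -- parameter `c`.
  obtain ⟨q, hq⟩ : ∃ q, (1 - z) ^ ((c : ℂ) + 1 - a - b) = q * (1 - z) :=
    ⟨_, (div_mul_cancel₀ _ ht0).symm⟩
  rw [hq, mul_div_assoc, mul_div_cancel_right₀ _ ht0] at r0
  rw [hq, mul_div_cancel_right₀ _ ht0]
  apply mul_left_cancel₀ hc0
  rw [← r0]
  field_simp
  field_simp at r1
  linear_combination k₁ * r1 + k₂ * q * (c - a - b) * r2

/-! ### Large `c`, Euler's product and the connection coefficients. -/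

/-- The factor `1/c` makes the bound small and `1/(n+2)²` makes it summable. The constant `4 m²`
makes the case `n = 0` read `|a b| ≤ m²`; the induction then only needs the ratio of coefficients to
be at most `(n+2)²/(n+3)²`. -/
theorem norm_ordinaryHypergeometricCoefficient_le {a b c m : ℝ} (hm : 1 ≤ m) (ha : |a| ≤ m)
    (hb : |b| ≤ m) (hc : 4 * (m + 2) ^ 2 ≤ c) (n : ℕ) :
    ‖ordinaryHypergeometricCoefficient (a : ℂ) (b : ℂ) (c : ℂ) (n + 1)‖
      ≤ 4 * m ^ 2 / c * (1 / ((n : ℝ) + 2) ^ 2) := by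
  have hc0 : 0 < c := lt_of_lt_of_le (by positivity) hc
  have hne : ∀ n : ℕ, (n : ℂ) + (c : ℂ) ≠ 0 := fun n => by
    have : (n : ℝ) + c ≠ 0 := by positivity
    exact_mod_cast this
  have key : ∀ n : ℕ, ((n : ℝ) + 1) * (n + c)
      * ‖ordinaryHypergeometricCoefficient (a : ℂ) (b : ℂ) (c : ℂ) (n + 1)‖
      ≤ (n + m) ^ 2 * ‖ordinaryHypergeometricCoefficient (a : ℂ) (b : ℂ) (c : ℂ) n‖ := by
    intro n
    have h := congrArg norm (ordinaryHypergeometricCoefficient_succ (a := a) (b := b) hne n)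
    generalize ordinaryHypergeometricCoefficient (a : ℂ) (b : ℂ) (c : ℂ) (n + 1) = u₁ at *
    generalize ordinaryHypergeometricCoefficient (a : ℂ) (b : ℂ) (c : ℂ) n = u₀ at *
    rw [norm_mul, norm_mul, norm_mul, norm_mul] at h
    have e1 : ‖(n : ℂ) + 1‖ = (n : ℝ) + 1 := by
      rw [← Nat.cast_one, ← Nat.cast_add, Complex.norm_natCast]
      push_cast
      rfl
    have e2 : ∀ x : ℝ, ‖(n : ℂ) + x‖ = |(n : ℝ) + x| := fun x => by
      rw [← Complex.ofReal_natCast, ← Complex.ofReal_add, Complex.norm_real, Real.norm_eq_abs]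
    have e3 : ∀ x : ℝ, |x| ≤ m → |(n : ℝ) + x| ≤ n + m := fun x hx =>
      (abs_add_le _ _).trans (by rw [abs_of_nonneg (Nat.cast_nonneg n)]; linarith)
    rw [e1, e2, e2, e2, abs_of_pos (by positivity : 0 < (n : ℝ) + c)] at h
    rw [h, sq]
    gcongr
    · exact e3 a ha
    · exact e3 b hb
  induction n with
  | zero =>
    have h := key 0
    rw [ordinaryHypergeometricCoefficient_zero] at h
    simp only [Nat.cast_zero, norm_one] at h ⊢
    rw [show 4 * m ^ 2 / c * (1 / (0 + 2) ^ 2) = m ^ 2 / c by field_simp; ring, le_div_iff₀ hc0]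
    linarith
  | succ n ih =>
    have h := key (n + 1)
    push_cast at h ⊢
    have hn : (0 : ℝ) ≤ n := Nat.cast_nonneg n
    have hpos : 0 < ((n : ℝ) + 1 + 1) * (n + 1 + c) := by positivity
    have poly : ((n : ℝ) + 1 + m) ^ 2 * (n + 1 + 2) ^ 2 ≤ (n + 1 + 1) * (n + 1 + c) * (n + 2) ^ 2 := by
      have h1 : ((n : ℝ) + 1 + m) ^ 2 * (n + 1 + 2) ^ 2
          ≤ (n + 1 + 1) * (n + 1 + 4 * (m + 2) ^ 2) * (n + 2) ^ 2 := by
        -- In terms of `p = m - 1 ≥ 0` every coefficient of the difference is positive.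
        obtain ⟨p, rfl⟩ : ∃ p, m = 1 + p := ⟨m - 1, by ring⟩
        have hp : 0 ≤ p := by linarith
        rw [← sub_nonneg]
        have : (n + 1 + 1) * (n + 1 + 4 * (1 + p + 2) ^ 2) * ((n : ℝ) + 2) ^ 2
          - ((n : ℝ) + 1 + (1 + p)) ^ 2 * (n + 1 + 2) ^ 2
          = 4 * n ^ 3 * p ^ 2 + 22 * n ^ 3 * p + 33 * n ^ 3 + 23 * n ^ 2 * p ^ 2 + 128 * n ^ 2 * p
            + 197 * n ^ 2 + 42 * n * p ^ 2 + 246 * n * p + 392 * n + 23 * p ^ 2 + 156 * p + 260 := by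
          ring
        rw [this]
        positivity
      refine h1.trans ?_
      gcongr
    calc ‖ordinaryHypergeometricCoefficient (a : ℂ) (b : ℂ) (c : ℂ) (n + 1 + 1)‖
        ≤ ((n : ℝ) + 1 + m) ^ 2 * ‖ordinaryHypergeometricCoefficient (a : ℂ) (b : ℂ) (c : ℂ) (n + 1)‖
          / ((n + 1 + 1) * (n + 1 + c)) := by
          rw [le_div_iff₀ hpos]
          linarith
      _ ≤ ((n : ℝ) + 1 + m) ^ 2 * (4 * m ^ 2 / c * (1 / ((n : ℝ) + 2) ^ 2))
          / ((n + 1 + 1) * (n + 1 + c)) := by gcongr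
      _ ≤ 4 * m ^ 2 / c * (1 / ((n : ℝ) + 1 + 2) ^ 2) := by
          have h2 : (0 : ℝ) < ((n : ℝ) + 2) ^ 2 := by positivity
          have h3 : (0 : ℝ) < ((n : ℝ) + 1 + 2) ^ 2 := by positivity
          rw [mul_left_comm, mul_div_assoc]
          refine mul_le_mul_of_nonneg_left ?_ (by positivity)
          rw [mul_one_div, div_div, div_le_div_iff₀ (by positivity) h3]
          linarith

/-- `₂F₁(a, b, c, ·)` is uniformly close to `1` on the unit disc for large `c`. -/
theorem exists_norm_gauss2F1_sub_one_le (a b : ℝ) : ∃ K M : ℝ, ∀ c : ℝ, M ≤ c → (∀ n : ℤ, c ≠ n) →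
    ∀ z ∈ Metric.ball (0 : ℂ) 1, ‖gauss2F1 a b c z - 1‖ ≤ K / c := by
  set m := max 1 (max |a| |b|) with hm
  have hm1 : 1 ≤ m := le_max_left _ _
  have hma : |a| ≤ m := (le_max_left _ _).trans (le_max_right _ _)
  have hmb : |b| ≤ m := (le_max_right _ _).trans (le_max_right _ _)
  have hsum : Summable fun n : ℕ => 1 / ((n : ℝ) + 2) ^ 2 := by
    have := (summable_nat_add_iff 2).2 (Real.summable_one_div_nat_pow.2 one_lt_two)
    refine this.congr fun n => ?_
    push_cast
    rfl
  refine ⟨4 * m ^ 2 * ∑' n : ℕ, 1 / ((n : ℝ) + 2) ^ 2, 4 * (m + 2) ^ 2, fun c hMc hc z hz => ?_⟩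
  have h := hasSum_taylorCoeff
    ((isHyperSol_gauss2F1 a b hc).differentiableOn.mono ball_subset_cutPlane) hz
  have h1 := (hasSum_nat_add_iff' 1).2 h
  simp only [Finset.sum_range_one, pow_zero, mul_one, taylorCoeff_zero, gauss2F1_zero a b hc] at h1
  have h2 := (hsum.mul_left (4 * m ^ 2 / c)).hasSum
  have h3 := h1.norm_le_of_bounded h2 fun n => by
    rw [taylorCoeff_gauss2F1 a b hc, norm_mul, norm_pow]
    refine (mul_le_of_le_one_right (norm_nonneg _) (pow_le_one₀ (norm_nonneg _) ?_)).trans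
      (norm_ordinaryHypergeometricCoefficient_le hm1 hma hmb hMc n)
    rw [mem_ball_zero_iff] at hz
    exact hz.le
  rwa [tsum_mul_left, div_mul_eq_mul_div] at h3

/-- For `c - a - b > 0` the second solution at `1` tends to zero there while the first tends to `1`,
so the first connection coefficient is the boundary value. -/
theorem IsConnection.tendsto {a b c : ℝ} (hcab : ∀ n : ℤ, c - a - b ≠ n) (hpos : 0 < c - a - b)
    {k₁ k₂ : ℂ} (h : IsConnection a b c k₁ k₂) :
    Tendsto (fun x : ℝ => gauss2F1 a b c x) (𝓝[<] 1) (𝓝 k₁) := by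
  have hr := reflected_ne_int hcab
  have hev : ∀ᶠ x : ℝ in 𝓝[<] 1, (x : ℂ) ∈ doubleCutPlane := by
    filter_upwards [Ioo_mem_nhdsLT (zero_lt_one (α := ℝ))] with x hx
    exact ofReal_mem_doubleCutPlane hx.1 hx.2
  have ht : Tendsto (fun x : ℝ => 1 - (x : ℂ)) (𝓝[<] 1) (𝓝 0) := by
    have : Continuous fun x : ℝ => 1 - (x : ℂ) := by fun_prop
    have h1 := this.tendsto 1
    simp only [Complex.ofReal_one, sub_self] at h1
    exact h1.mono_left nhdsWithin_le_nhds
  have hg : ∀ A B C : ℝ, (∀ n : ℤ, C ≠ n) →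
      Tendsto (fun x : ℝ => gauss2F1 A B C (1 - x)) (𝓝[<] 1) (𝓝 1) := fun A B C hC => by
    have := (analyticOnNhd_gauss2F1 A B hC 0 zero_mem_cutPlane).continuousAt.tendsto
    rw [gauss2F1_zero A B hC] at this
    exact this.comp ht
  have hp : Tendsto (fun x : ℝ => (1 - (x : ℂ)) ^ (1 - ((a + b - c + 1 : ℝ) : ℂ))) (𝓝[<] 1)
      (𝓝 0) := by
    have hre : 0 < (1 - ((a + b - c + 1 : ℝ) : ℂ)).re := by
      simp
      linarith
    have := (Complex.continuousAt_cpow_const_of_re_pos (z := 0) (Or.inl (by simp)) hre).tendsto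
    rw [Complex.zero_cpow (fun h => by
      rw [h, Complex.zero_re] at hre
      exact lt_irrefl _ hre)] at this
    exact this.comp ht
  have hlim := ((hg a b _ hr).const_mul k₁).add ((hp.mul (hg (1 + a - (a + b - c + 1))
    (1 + b - (a + b - c + 1)) _ (two_sub_ne_int hr))).const_mul k₂)
  simp only [mul_one, mul_zero, add_zero] at hlim
  exact hlim.congr' (hev.mono fun x hx => (h x hx).symm)

/-- The quotient `Γ(c) Γ(c - a - b) / (Γ(c - a) Γ(c - b))`. -/
def gammaRatio (a b c : ℝ) : ℝ :=
  Real.Gamma c * Real.Gamma (c - a - b) / (Real.Gamma (c - a) * Real.Gamma (c - b))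

/-- At a pole of `Γ` the product in the denominator of `GammaSeq` eventually contains a zero factor,
so both sides are `0` under the convention for division by zero. -/
theorem tendsto_inv_GammaSeq (s : ℝ) :
    Tendsto (fun n => (Real.GammaSeq s n)⁻¹) atTop (𝓝 (Real.Gamma s)⁻¹) := by
  by_cases h : Real.Gamma s = 0
  · obtain ⟨m, rfl⟩ := (Real.Gamma_eq_zero_iff s).1 h
    rw [h]
    refine tendsto_const_nhds.congr' ?_
    filter_upwards [eventually_ge_atTop m] with n hn
    rw [Real.GammaSeq, Finset.prod_eq_zero (i := m) (by simp; omega) (by simp), div_zero]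
  · exact (Real.GammaSeq_tendsto_Gamma s).inv₀ h

/-- Euler's limit formula for `Γ`: the powers of `n` cancel because `c + (c - a - b) = (c - a) + (c
- b)`, and the factorials cancel in pairs. -/
theorem tendsto_prod_gammaRatio (a b c : ℝ) :
    Tendsto (fun n : ℕ => ∏ j ∈ Finset.range (n + 1),
      (c + j - a) * (c + j - b) / ((c + j) * (c + j - a - b))) atTop (𝓝 (gammaRatio a b c)) := by
  have h := (((Real.GammaSeq_tendsto_Gamma c).mul (Real.GammaSeq_tendsto_Gamma (c - a - b))).mul
    (tendsto_inv_GammaSeq (c - a))).mul (tendsto_inv_GammaSeq (c - b))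
  have e : Real.Gamma c * Real.Gamma (c - a - b) * (Real.Gamma (c - a))⁻¹ * (Real.Gamma (c - b))⁻¹
      = gammaRatio a b c := by
    rw [gammaRatio, div_eq_mul_inv, mul_inv]
    ring
  rw [e] at h
  refine h.congr' ?_
  filter_upwards [eventually_gt_atTop 0] with n hn
  have hn' : (0 : ℝ) < n := by exact_mod_cast hn
  have hp : ∀ s : ℝ, (n : ℝ) ^ s ≠ 0 := fun s => (Real.rpow_pos_of_pos hn' s).ne'
  have hf : (n.factorial : ℝ) ≠ 0 := by exact_mod_cast n.factorial_ne_zero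
  simp only [Real.GammaSeq, Finset.prod_div_distrib, Finset.prod_mul_distrib]
  have q1 : ∏ j ∈ Finset.range (n + 1), (c + j - a) = ∏ j ∈ Finset.range (n + 1), (c - a + j) :=
    Finset.prod_congr rfl fun j _ => by ring
  have q2 : ∏ j ∈ Finset.range (n + 1), (c + j - b) = ∏ j ∈ Finset.range (n + 1), (c - b + j) :=
    Finset.prod_congr rfl fun j _ => by ring
  have q3 : ∏ j ∈ Finset.range (n + 1), (c + j - a - b)
      = ∏ j ∈ Finset.range (n + 1), (c - a - b + j) :=
    Finset.prod_congr rfl fun j _ => by ring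
  have hpp : (n : ℝ) ^ c * (n : ℝ) ^ (c - a - b) = (n : ℝ) ^ (c - a) * (n : ℝ) ^ (c - b) := by
    rw [← Real.rpow_add hn', ← Real.rpow_add hn']
    congr 1
    ring
  have hr : (n : ℝ) ^ c * (n : ℝ) ^ (c - a - b) * (((n : ℝ) ^ (c - a))⁻¹ * ((n : ℝ) ^ (c - b))⁻¹)
      = 1 := by
    rw [hpp, ← mul_inv, mul_inv_cancel₀ (mul_ne_zero (hp _) (hp _))]
  rw [q1, q2, q3]
  generalize ∏ j ∈ Finset.range (n + 1), (c - a + j) = P1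
  generalize ∏ j ∈ Finset.range (n + 1), (c - b + j) = P2
  generalize ∏ j ∈ Finset.range (n + 1), (c - a - b + j) = P3
  generalize ∏ j ∈ Finset.range (n + 1), (c + j) = P4
  have hfi : (n.factorial : ℝ) * (n.factorial : ℝ)⁻¹ = 1 := mul_inv_cancel₀ hf
  -- The products are allowed to vanish: the identity is formal in them and their inverses.
  simp only [div_eq_mul_inv, mul_inv, inv_inv]
  linear_combination (P1 * P2 * P3⁻¹ * P4⁻¹) * (n.factorial * (n.factorial : ℝ)⁻¹) ^ 2 * hr
    + (P1 * P2 * P3⁻¹ * P4⁻¹) * (n.factorial * (n.factorial : ℝ)⁻¹ + 1) * hfi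

theorem IsConnection.iterate {a b c : ℝ} (hc : ∀ n : ℤ, c ≠ n) (hcab : ∀ n : ℤ, c - a - b ≠ n)
    (N : ℕ) {k₁ k₂ : ℂ} (h : IsConnection a b (c + N) k₁ k₂) :
    ∃ k, IsConnection a b c (k₁ * ((∏ j ∈ Finset.range N,
      (c + j - a) * (c + j - b) / ((c + j) * (c + j - a - b)) : ℝ) : ℂ)) k := by
  induction N generalizing k₁ k₂ with
  | zero => exact ⟨k₂, by simpa using h⟩
  | succ N ih =>
    have hcN := add_nat_ne_int hc N
    have hcabN : ∀ n : ℤ, c + N - a - b ≠ n := fun n h => hcab (n - N) (by push_cast; linarith)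
    have h' : IsConnection a b (c + N + 1) k₁ k₂ := by
      have e : c + ((N + 1 : ℕ) : ℝ) = c + N + 1 := by push_cast; ring
      rwa [e] at h
    obtain ⟨k, hk⟩ := ih (h'.step hcN hcabN)
    refine ⟨k, ?_⟩
    rw [Finset.prod_range_succ]
    convert hk using 1
    push_cast
    ring

/-- The coefficient at `c` is the one at `c + N` times a finite product. The former tends to `1`,
since `₂F₁` with third parameter `c + N` tends to `1` uniformly on the disc, and the product tends
to the Gamma quotient. -/
theorem IsConnection.fst_eq {a b c : ℝ} (hc : ∀ n : ℤ, c ≠ n) (hcab : ∀ n : ℤ, c - a - b ≠ n)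
    {k₁ k₂ : ℂ} (h : IsConnection a b c k₁ k₂) : k₁ = gammaRatio a b c := by
  have hcabN : ∀ N : ℕ, ∀ n : ℤ, c + N - a - b ≠ n := fun N n h =>
    hcab (n - N) (by push_cast; linarith)
  choose κ₁ κ₂ hκ using fun N : ℕ => exists_isConnection (add_nat_ne_int hc N) (hcabN N)
  have hlim1 : Tendsto κ₁ atTop (𝓝 1) := by
    obtain ⟨K, M, hKM⟩ := exists_norm_gauss2F1_sub_one_le a b
    have hcN : Tendsto (fun N : ℕ => c + N) atTop atTop :=
      tendsto_atTop_add_const_left _ _ tendsto_natCast_atTop_atTop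
    rw [tendsto_iff_norm_sub_tendsto_zero]
    refine squeeze_zero' (Eventually.of_forall fun _ => norm_nonneg _) ?_
      (hcN.const_div_atTop K)
    filter_upwards [hcN.eventually_ge_atTop M, hcN.eventually_gt_atTop (a + b)] with N h1 h2
    have ht := ((hκ N).tendsto (hcabN N) (by linarith)).sub_const 1 |>.norm
    refine le_of_tendsto ht ?_
    filter_upwards [Ioo_mem_nhdsLT (zero_lt_one (α := ℝ))] with x hx
    refine hKM _ h1 (add_nat_ne_int hc N) _ ?_
    rw [mem_ball_zero_iff, Complex.norm_real, Real.norm_eq_abs, abs_of_pos hx.1]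
    exact hx.2
  -- Euler's product at stage `N` has `N + 1` factors, hence the shift by one.
  have hlim2 := (hlim1.comp (tendsto_add_atTop_nat 1)).mul
    ((Complex.continuous_ofReal.tendsto _).comp (tendsto_prod_gammaRatio a b c))
  rw [one_mul] at hlim2
  refine tendsto_nhds_unique (tendsto_const_nhds.congr fun N => ?_) hlim2
  obtain ⟨k, hk⟩ := (hκ (N + 1)).iterate hc hcab
  exact (h.unique hcab hk).1

/-- Euler's transformation interchanges the exponents `0` and `c - a - b` at `1`, so the second
coefficient for `(a, b)` is the first one for `(c - a, c - b)`. -/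
theorem isConnection_gammaRatio {a b c : ℝ} (hc : ∀ n : ℤ, c ≠ n)
    (hcab : ∀ n : ℤ, c - a - b ≠ n) :
    IsConnection a b c (gammaRatio a b c) (gammaRatio (c - a) (c - b) c) := by
  have hcab' : ∀ n : ℤ, c - (c - a) - (c - b) ≠ n := fun n h => hcab (-n) (by push_cast; linarith)
  have hs1 : ∀ n : ℤ, c - a - b + 1 ≠ n := by exact_mod_cast add_nat_ne_int hcab 1
  obtain ⟨k₁, k₂, hk⟩ := exists_isConnection hc hcab
  obtain ⟨l₁, l₂, hl⟩ := exists_isConnection hc hcab'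
  have hl' : IsConnection a b c l₂ l₁ := by
    intro z hz
    have ht := one_sub_mem_doubleCutPlane hz
    have ht0 := Complex.slitPlane_ne_zero ht.2
    have h1 := hl z hz
    rw [Fminus, Fplus, show c - a + (c - b) - c + 1 = c - a - b + 1 by ring,
      show 1 + (c - a) - (c - a - b + 1) = b by ring,
      show 1 + (c - b) - (c - a - b + 1) = a by ring,
      show 2 - (c - a - b + 1) = a + b - c + 1 by ring,
      gauss2F1_symm b a (reflected_ne_int hcab) ht.1,
      gauss2F1_symm (c - a) (c - b) hs1 ht.1] at h1
    rw [gauss2F1_euler a b hc hz.1, h1, Fminus, Fplus,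
      show 1 + a - (a + b - c + 1) = c - b by ring,
      show 1 + b - (a + b - c + 1) = c - a by ring,
      show 2 - (a + b - c + 1) = c - a - b + 1 by ring,
      show 1 - ((a + b - c + 1 : ℝ) : ℂ) = (c : ℂ) - a - b by push_cast; ring,
      show 1 - ((c - a - b + 1 : ℝ) : ℂ) = -((c : ℂ) - a - b) by push_cast; ring]
    have e : (1 - z) ^ ((c : ℂ) - a - b) * (1 - z) ^ (-((c : ℂ) - a - b)) = 1 := by
      rw [← Complex.cpow_add _ _ ht0, add_neg_cancel, Complex.cpow_zero]
    linear_combination l₂ * gauss2F1 a b (a + b - c + 1) (1 - z) * e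
  obtain ⟨e1, e2⟩ := hk.unique hcab hl'
  rw [← hk.fst_eq hc hcab, ← hl.fst_eq hc hcab', ← e2]
  exact hk

theorem Fminus_connection {a b c : ℝ} (hc : ∀ n : ℤ, c ≠ n) (hcab : ∀ n : ℤ, c - a - b ≠ n) {z : ℂ}
    (hz : z ∈ doubleCutPlane) :
    Fminus a b c z = gammaRatio a b c * Fminus a b (a + b - c + 1) (1 - z)
      + gammaRatio (c - a) (c - b) c * Fplus a b (a + b - c + 1) (1 - z) :=
  isConnection_gammaRatio hc hcab z hz

/-- The connection formula is used for `(1 + a - c, 1 + b - c, 2 - c)`. The extra factor `z ^ (1 -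
c)` is absorbed by Euler's transformation at `1`, where it reads `(1 - t) ^ (1 - c)` with `t = 1 -
z`. -/
theorem Fplus_connection {a b c : ℝ} (hc : ∀ n : ℤ, c ≠ n) (hcab : ∀ n : ℤ, c - a - b ≠ n) {z : ℂ}
    (hz : z ∈ doubleCutPlane) :
    Fplus a b c z = gammaRatio (1 + a - c) (1 + b - c) (2 - c) * Fminus a b (a + b - c + 1) (1 - z)
      + gammaRatio (1 - a) (1 - b) (2 - c) * Fplus a b (a + b - c + 1) (1 - z) := by
  have hr := reflected_ne_int hcab
  have hs1 : ∀ n : ℤ, c - a - b + 1 ≠ n := by exact_mod_cast add_nat_ne_int hcab 1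
  have ht := one_sub_mem_doubleCutPlane hz
  have h := isConnection_gammaRatio (a := 1 + a - c) (b := 1 + b - c) (two_sub_ne_int hc)
    (fun n h => hcab n (by linarith)) z hz
  rw [Fminus, Fplus, show 1 + a - c + (1 + b - c) - (2 - c) + 1 = a + b - c + 1 by ring,
    show 2 - c - (1 + a - c) = 1 - a by ring, show 2 - c - (1 + b - c) = 1 - b by ring,
    show 1 + (1 + a - c) - (a + b - c + 1) = 1 - b by ring,
    show 1 + (1 + b - c) - (a + b - c + 1) = 1 - a by ring,
    show 2 - (a + b - c + 1) = c - a - b + 1 by ring] at h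
  have e1 := gauss2F1_euler a b hr ht.1
  rw [show a + b - c + 1 - a = 1 + b - c by ring, show a + b - c + 1 - b = 1 + a - c by ring,
    gauss2F1_symm (1 + b - c) (1 + a - c) hr ht.1,
    show ((a + b - c + 1 : ℝ) : ℂ) - a - b = 1 - c by push_cast; ring, sub_sub_cancel] at e1
  have e2 := gauss2F1_euler (c - b) (c - a) hs1 ht.1
  rw [show c - a - b + 1 - (c - b) = 1 - a by ring, show c - a - b + 1 - (c - a) = 1 - b by ring,
    gauss2F1_symm (1 - a) (1 - b) hs1 ht.1,
    show ((c - a - b + 1 : ℝ) : ℂ) - ((c - b : ℝ) : ℂ) - ((c - a : ℝ) : ℂ) = 1 - c by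
      push_cast; ring, sub_sub_cancel] at e2
  rw [Fplus, h, Fminus, Fplus, show 1 + a - (a + b - c + 1) = c - b by ring,
      show 1 + b - (a + b - c + 1) = c - a by ring,
      show 2 - (a + b - c + 1) = c - a - b + 1 by ring, e1, e2]
  ring

/-! ### Wirtinger calculus and the local form of solutions. -/

theorem dz_of_hasDerivAt {f : ℂ → ℂ} {f' z : ℂ} (h : HasDerivAt f f' z) : dz f z = f' := by
  have h1 : HasFDerivAt f _ z := h.hasFDerivAt.restrictScalars ℝ
  rw [dz, h1.fderiv]
  simp
  linear_combination (-f' / 2) * Complex.I_mul_I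

theorem dz_mul {f g : ℂ → ℂ} {z : ℂ} (hf : DifferentiableAt ℝ f z) (hg : DifferentiableAt ℝ g z) :
    dz (fun w => f w * g w) z = dz f z * g z + f z * dz g z := by
  unfold dz
  rw [fderiv_fun_mul hf hg]
  simp only [add_apply, smul_apply, smul_eq_mul]
  ring

theorem fderiv_conj {f : ℂ → ℂ} {z : ℂ} (hf : DifferentiableAt ℝ f z) (v : ℂ) :
    fderiv ℝ (fun w => conj (f w)) z v = conj (fderiv ℝ f z v) := by
  have h := (Complex.conjCLE.toContinuousLinearMap.hasFDerivAt (x := f z)).comp z hf.hasFDerivAt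
  have h' : HasFDerivAt (fun w => conj (f w)) _ z := h
  rw [h'.fderiv]
  simp

theorem differentiableAt_conj {f : ℂ → ℂ} {z : ℂ} (hf : DifferentiableAt ℝ f z) :
    DifferentiableAt ℝ (fun w => conj (f w)) z :=
  Complex.conjCLE.differentiableAt.comp z hf

theorem dz_conj {f : ℂ → ℂ} {z : ℂ} (h : DifferentiableAt ℂ f z) :
    dz (fun w => conj (f w)) z = 0 := by
  have h1 : HasFDerivAt f _ z := h.hasDerivAt.hasFDerivAt.restrictScalars ℝ
  rw [dz, fderiv_conj h1.differentiableAt, fderiv_conj h1.differentiableAt, h1.fderiv]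
  simp
  linear_combination (conj (deriv f z)) * Complex.I_mul_I

theorem differentiableAt_conj_of_dz_eq_zero {A : ℂ → ℂ} {z : ℂ} (hA : DifferentiableAt ℝ A z)
    (h : dz A z = 0) : DifferentiableAt ℂ (fun w => conj (A w)) z := by
  rw [differentiableAt_complex_iff_differentiableAt_real]
  refine ⟨differentiableAt_conj hA, ?_⟩
  rw [fderiv_conj hA, fderiv_conj hA]
  rw [dz] at h
  have e : fderiv ℝ A z Complex.I = -Complex.I * fderiv ℝ A z 1 := by
    linear_combination (2 * Complex.I) * h + fderiv ℝ A z Complex.I * Complex.I_mul_I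
  rw [e]
  simp

theorem dz_mul_conj {g f : ℂ → ℂ} {z : ℂ} (hg : DifferentiableAt ℂ g z)
    (hf : DifferentiableAt ℂ f z) :
    dz (fun w => g w * conj (f w)) z = deriv g z * conj (f z) := by
  rw [dz_mul (hg.restrictScalars ℝ) (differentiableAt_conj (hf.restrictScalars ℝ)), dz_conj hf,
    dz_of_hasDerivAt hg.hasDerivAt, mul_zero, add_zero]

theorem dz_mul_conj_add {g₁ g₂ f₁ f₂ : ℂ → ℂ} {z : ℂ} (hg₁ : DifferentiableAt ℂ g₁ z)
    (hg₂ : DifferentiableAt ℂ g₂ z) (hf₁ : DifferentiableAt ℂ f₁ z)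
    (hf₂ : DifferentiableAt ℂ f₂ z) :
    dz (fun w => g₁ w * conj (f₁ w) + g₂ w * conj (f₂ w)) z
      = deriv g₁ z * conj (f₁ z) + deriv g₂ z * conj (f₂ z) := by
  rw [dz_add (f := fun w => g₁ w * conj (f₁ w)) (g := fun w => g₂ w * conj (f₂ w)),
    dz_mul_conj hg₁ hf₁, dz_mul_conj hg₂ hf₂]
  · exact (hg₁.restrictScalars ℝ).mul (differentiableAt_conj (hf₁.restrictScalars ℝ))
  · exact (hg₂.restrictScalars ℝ).mul (differentiableAt_conj (hf₂.restrictScalars ℝ))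

/-- After conjugation the `conj gᵢ` are constants for `∂_z`. The relation and its `∂_z`-derivative
form a linear system for them whose determinant is the Wronskian. -/
theorem eq_zero_of_mul_conj_add_eq_zero {g₁ g₂ f₁ f₂ : ℂ → ℂ} {Ω : Set ℂ} (hΩ : IsOpen Ω)
    (hg₁ : DifferentiableOn ℂ g₁ Ω) (hg₂ : DifferentiableOn ℂ g₂ Ω)
    (hf₁ : DifferentiableOn ℂ f₁ Ω) (hf₂ : DifferentiableOn ℂ f₂ Ω)
    (hw : ∀ z ∈ Ω, wronskian f₁ f₂ z ≠ 0)
    (h : ∀ z ∈ Ω, g₁ z * conj (f₁ z) + g₂ z * conj (f₂ z) = 0) {z : ℂ} (hz : z ∈ Ω) :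
    g₁ z = 0 ∧ g₂ z = 0 := by
  have h' : ∀ z ∈ Ω, f₁ z * conj (g₁ z) + f₂ z * conj (g₂ z) = 0 := fun z hz => by
    have := congrArg conj (h z hz)
    simp only [map_add, map_mul, Complex.conj_conj, map_zero] at this
    linear_combination this
  have hn := hΩ.mem_nhds hz
  have d := dz_mul_conj_add (hf₁.differentiableAt hn) (hf₂.differentiableAt hn)
    (hg₁.differentiableAt hn) (hg₂.differentiableAt hn)
  rw [dz_congr (g := fun _ => 0) (eventually_of_mem hn h'),
    dz_of_hasDerivAt (hasDerivAt_const z 0)] at d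
  have e0 := h' z hz
  have hw := hw z hz
  rw [wronskian] at hw
  constructor
  · apply (map_eq_zero conj).1
    refine (mul_eq_zero.1 ?_).resolve_right hw
    linear_combination deriv f₂ z * e0 + f₂ z * d
  · apply (map_eq_zero conj).1
    refine (mul_eq_zero.1 ?_).resolve_right hw
    linear_combination -f₁ z * d - deriv f₁ z * e0

theorem ne_zero_of_mem_puncturedPlane {z : ℂ} (hz : z ∈ puncturedPlane) : z ≠ 0 := fun h =>
  hz (by simp [h])

theorem one_sub_ne_zero_of_mem_puncturedPlane {z : ℂ} (hz : z ∈ puncturedPlane) : 1 - z ≠ 0 :=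
  fun h => hz (by simp [(sub_eq_zero.1 h).symm])

theorem pde_iff {a b c : ℂ} {z y₀ y₁ y₂ : ℂ} (hz : z ∈ puncturedPlane) :
    y₂ + (c - z * (a + b + 1)) / (z * (1 - z)) * y₁ - (a * b) / (z * (1 - z)) * y₀ = 0
      ↔ z * (1 - z) * y₂ + (c - (a + b + 1) * z) * y₁ - a * b * y₀ = 0 := by
  have h0 := ne_zero_of_mem_puncturedPlane hz
  have h1 := one_sub_ne_zero_of_mem_puncturedPlane hz
  have e : z * (1 - z) * y₂ + (c - (a + b + 1) * z) * y₁ - a * b * y₀ = z * (1 - z) *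
      (y₂ + (c - z * (a + b + 1)) / (z * (1 - z)) * y₁ - (a * b) / (z * (1 - z)) * y₀) := by
    field_simp
  rw [e, mul_eq_zero]
  simp [h0, h1]

/-- The quotient of the Wronskians of `(T, f)` and `(f₁, f₂)` is antiholomorphic. -/
theorem differentiableAt_conj_wronskian_div {a b c : ℝ} {T : ℂ → ℝ} (hT : IsSolution a b c T)
    {f f₁ f₂ : ℂ → ℂ} {Ω : Set ℂ} (hΩ : IsOpen Ω) (hΩp : Ω ⊆ puncturedPlane)
    (h : IsHyperSol a b c f Ω) (h₁ : IsHyperSol a b c f₁ Ω) (h₂ : IsHyperSol a b c f₂ Ω)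
    (hw : ∀ z ∈ Ω, wronskian f₁ f₂ z ≠ 0) {z : ℂ} (hz : z ∈ Ω) :
    DifferentiableAt ℂ (fun w => conj (((T w : ℂ) * deriv f w - f w * dz (fun w => (T w : ℂ)) w)
      * (wronskian f₁ f₂ w)⁻¹)) z := by
  have hzp := hΩp hz
  have hτ := differentiableAt_ofReal hT.1 hzp
  have hτ' := differentiableAt_dz_ofReal hT.1 hzp
  have hf := h.analyticAt hΩ hz
  have hf0 := hf.differentiableAt.restrictScalars ℝ
  have hf1 := hf.deriv.differentiableAt.restrictScalars ℝ
  have hW := hasDerivAt_wronskian (h₁.analyticAt hΩ hz) (h₂.analyticAt hΩ hz)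
  have hWi := hW.fun_inv (hw z hz)
  have hWr := hWi.differentiableAt.restrictScalars ℝ
  have p1 := hτ.fun_mul hf1
  have p2 := hf0.fun_mul hτ'
  have hN := p1.fun_sub p2
  refine differentiableAt_conj_of_dz_eq_zero (hN.fun_mul hWr) ?_
  have eN : dz (fun w => (T w : ℂ) * deriv f w - f w * dz (fun w => (T w : ℂ)) w) z
      = T z * deriv (deriv f) z - f z * dz (dz fun w => (T w : ℂ)) z := by
    have e : (fun w => (T w : ℂ) * deriv f w - f w * dz (fun w => (T w : ℂ)) w)
        = fun w => (T w : ℂ) * deriv f w + (-1) * (f w * dz (fun w => (T w : ℂ)) w) := by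
      funext w
      ring
    rw [e, dz_add p1 (p2.const_mul (-1)), dz_const_mul _ p2, dz_mul hτ hf1, dz_mul hf0 hτ',
      dz_of_hasDerivAt hf.deriv.differentiableAt.hasDerivAt,
      dz_of_hasDerivAt hf.differentiableAt.hasDerivAt]
    ring
  rw [dz_mul hN hWr, eN, dz_of_hasDerivAt hWi]
  -- `T` and `f` satisfy the same equation in `∂_z`, so the numerator obeys Abel's identity with the
  -- same factor as the Wronskian, and `∂_z` of the quotient vanishes.
  have e1 := (pde_iff hzp).1 (hT.2 z hzp)
  have e2 := hyperOp_wronskian (h₁.hyperOp_eq_zero z hz) (h₂.hyperOp_eq_zero z hz)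
  have e3 := h.hyperOp_eq_zero z hz
  rw [hyperOp] at e3
  have h0 := mul_ne_zero (ne_zero_of_mem_puncturedPlane hzp)
    (one_sub_ne_zero_of_mem_puncturedPlane hzp)
  have hwz := hw z hz
  apply mul_left_cancel₀ (mul_ne_zero h0 (pow_ne_zero 2 hwz))
  generalize dz (dz fun w => (T w : ℂ)) z = t₂ at *
  generalize dz (fun w => (T w : ℂ)) z = t₁ at *
  generalize f₁ z * deriv (deriv f₂) z - deriv (deriv f₁) z * f₂ z = W' at *
  generalize wronskian f₁ f₂ z = W at *
  field_simp
  linear_combination W * (T z) * e3 - W * f z * e1 - (T z * deriv f z - f z * t₁) * e2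

/-- Variation of constants with antiholomorphic constants. Once `T = B₁ conj f₁ + B₂ conj f₂` with
holomorphic `Bᵢ`, the operator acts on the `Bᵢ` alone, independence over the `conj fᵢ` makes each
`Bᵢ` a solution, and solutions are combinations of `f₁, f₂`. -/
theorem exists_bilinear_form {a b c : ℝ} {T : ℂ → ℝ} (hT : IsSolution a b c T) {f₁ f₂ : ℂ → ℂ}
    {Ω : Set ℂ} (hΩ : IsOpen Ω) (hΩc : IsPreconnected Ω) (hΩp : Ω ⊆ puncturedPlane)
    (h₁ : IsHyperSol a b c f₁ Ω) (h₂ : IsHyperSol a b c f₂ Ω)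
    (hw : ∀ z ∈ Ω, wronskian f₁ f₂ z ≠ 0) :
    ∃ m₁₁ m₁₂ m₂₁ m₂₂ : ℂ, ∀ z ∈ Ω, (T z : ℂ)
      = (m₁₁ * f₁ z + m₁₂ * f₂ z) * conj (f₁ z) + (m₂₁ * f₁ z + m₂₂ * f₂ z) * conj (f₂ z) := by
  set B₁ : ℂ → ℂ := fun w => conj (((T w : ℂ) * deriv f₂ w - f₂ w * dz (fun w => (T w : ℂ)) w)
      * (wronskian f₁ f₂ w)⁻¹) with hB₁
  set B₂ : ℂ → ℂ := fun w => (-1) * conj (((T w : ℂ) * deriv f₁ w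
      - f₁ w * dz (fun w => (T w : ℂ)) w) * (wronskian f₁ f₂ w)⁻¹) with hB₂
  have d₁ : DifferentiableOn ℂ B₁ Ω := fun z hz =>
    (differentiableAt_conj_wronskian_div hT hΩ hΩp h₂ h₁ h₂ hw hz).differentiableWithinAt
  have d₂ : DifferentiableOn ℂ B₂ Ω := fun z hz =>
    ((differentiableAt_conj_wronskian_div hT hΩ hΩp h₁ h₁ h₂ hw hz).const_mul
      (-1)).differentiableWithinAt
  have eT : ∀ z ∈ Ω, (T z : ℂ) = B₁ z * conj (f₁ z) + B₂ z * conj (f₂ z) := fun z hz => by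
    have hwz := hw z hz
    -- Reality of `T` enters here: Cramer's rule expresses `T` through `f₁, f₂` with antiholomorphic
    -- coefficients, and conjugating makes the coefficients holomorphic.
    rw [← Complex.conj_ofReal, hB₁, hB₂]
    simp only
    rw [mul_assoc (-1), ← map_mul, ← map_mul, neg_one_mul, ← map_neg, ← map_add]
    congr 1
    field_simp
    rw [wronskian]
    ring
  have a₁ : ∀ z ∈ Ω, AnalyticAt ℂ B₁ z := fun z hz => d₁.analyticAt (hΩ.mem_nhds hz)
  have a₂ : ∀ z ∈ Ω, AnalyticAt ℂ B₂ z := fun z hz => d₂.analyticAt (hΩ.mem_nhds hz)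
  have eT1 : ∀ z ∈ Ω, dz (fun w => (T w : ℂ)) z
      = deriv B₁ z * conj (f₁ z) + deriv B₂ z * conj (f₂ z) := fun z hz => by
    rw [dz_congr (eventually_of_mem (hΩ.mem_nhds hz) eT),
      dz_mul_conj_add (a₁ z hz).differentiableAt (a₂ z hz).differentiableAt
        (h₁.analyticAt hΩ hz).differentiableAt (h₂.analyticAt hΩ hz).differentiableAt]
  have eT2 : ∀ z ∈ Ω, dz (dz fun w => (T w : ℂ)) z
      = deriv (deriv B₁) z * conj (f₁ z) + deriv (deriv B₂) z * conj (f₂ z) := fun z hz => by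
    rw [dz_congr (eventually_of_mem (hΩ.mem_nhds hz) eT1),
      dz_mul_conj_add (a₁ z hz).deriv.differentiableAt (a₂ z hz).deriv.differentiableAt
        (h₁.analyticAt hΩ hz).differentiableAt (h₂.analyticAt hΩ hz).differentiableAt]
  have hop : ∀ z ∈ Ω, hyperOp a b c B₁ z = 0 ∧ hyperOp a b c B₂ z = 0 := fun z hz => by
    refine eq_zero_of_mul_conj_add_eq_zero hΩ
      (fun z hz => (analyticAt_hyperOp a b c (a₁ z hz)).differentiableAt.differentiableWithinAt)
      (fun z hz => (analyticAt_hyperOp a b c (a₂ z hz)).differentiableAt.differentiableWithinAt)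
      h₁.differentiableOn h₂.differentiableOn hw (fun z hz => ?_) hz
    have e := (pde_iff (hΩp hz)).1 (hT.2 z (hΩp hz))
    rw [eT2 z hz, eT1 z hz, eT z hz] at e
    rw [hyperOp, hyperOp]
    linear_combination e
  obtain ⟨m₁₁, m₁₂, hm₁⟩ := exists_eq_of_isHyperSol hΩ hΩc hΩp h₁ h₂ hw
    ⟨d₁, fun z hz => (hop z hz).1⟩
  obtain ⟨m₂₁, m₂₂, hm₂⟩ := exists_eq_of_isHyperSol hΩ hΩc hΩp h₁ h₂ hw
    ⟨d₂, fun z hz => (hop z hz).2⟩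
  refine ⟨m₁₁, m₁₂, m₂₁, m₂₂, fun z hz => ?_⟩
  rw [eT z hz, hm₁ z hz, hm₂ z hz]

theorem bilinear_form_eq_zero {f₁ f₂ : ℂ → ℂ} {Ω : Set ℂ} (hΩ : IsOpen Ω) (hne : Ω.Nonempty)
    (hf₁ : DifferentiableOn ℂ f₁ Ω) (hf₂ : DifferentiableOn ℂ f₂ Ω)
    (hw : ∀ z ∈ Ω, wronskian f₁ f₂ z ≠ 0) {m₁₁ m₁₂ m₂₁ m₂₂ : ℂ}
    (h : ∀ z ∈ Ω, (m₁₁ * f₁ z + m₁₂ * f₂ z) * conj (f₁ z)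
      + (m₂₁ * f₁ z + m₂₂ * f₂ z) * conj (f₂ z) = 0) :
    m₁₁ = 0 ∧ m₁₂ = 0 ∧ m₂₁ = 0 ∧ m₂₂ = 0 := by
  obtain ⟨z, hz⟩ := hne
  have hn := hΩ.mem_nhds hz
  have key : ∀ w ∈ Ω, m₁₁ * f₁ w + m₁₂ * f₂ w = 0 ∧ m₂₁ * f₁ w + m₂₂ * f₂ w = 0 := fun w hw' =>
    eq_zero_of_mul_conj_add_eq_zero hΩ (g₁ := fun z => m₁₁ * f₁ z + m₁₂ * f₂ z)
      (g₂ := fun z => m₂₁ * f₁ z + m₂₂ * f₂ z) ((hf₁.const_mul _).add (hf₂.const_mul _))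
      ((hf₁.const_mul _).add (hf₂.const_mul _)) hf₁ hf₂ hw h hw'
  have k₁ := eq_zero_of_wronskian_ne_zero (hf₁.analyticAt hn) (hf₂.analyticAt hn) (hw z hz)
    (eventually_of_mem hn fun w hw' => (key w hw').1)
  have k₂ := eq_zero_of_wronskian_ne_zero (hf₁.analyticAt hn) (hf₂.analyticAt hn) (hw z hz)
    (eventually_of_mem hn fun w hw' => (key w hw').2)
  exact ⟨k₁.1, k₁.2, k₂.1, k₂.2⟩

/-- Real combinations of the squared moduli of two holomorphic solutions solve the equation. -/
theorem solution_of_eventuallyEq {a b c : ℝ} {T : ℂ → ℝ} {f₁ f₂ : ℂ → ℂ} {l₁ l₂ : ℝ} {Ω : Set ℂ}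
    (hΩ : IsOpen Ω) (h₁ : IsHyperSol a b c f₁ Ω) (h₂ : IsHyperSol a b c f₂ Ω)
    (hT : ∀ z ∈ Ω, T z = l₁ * ‖f₁ z‖ ^ 2 + l₂ * ‖f₂ z‖ ^ 2) {z : ℂ} (hz : z ∈ Ω)
    (hzp : z ∈ puncturedPlane) :
    ContDiffAt ℝ 2 T z ∧ dz (dz (fun w => (T w : ℂ))) z
      + ((c : ℂ) - z * ((a : ℂ) + (b : ℂ) + 1)) / (z * (1 - z)) * dz (fun w => (T w : ℂ)) z
      - ((a : ℂ) * (b : ℂ)) / (z * (1 - z)) * (T z : ℂ) = 0 := by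
  have hn := hΩ.mem_nhds hz
  constructor
  · have c₁ : ContDiffAt ℝ 2 f₁ z := (h₁.analyticAt hΩ hz).contDiffAt.restrict_scalars ℝ
    have c₂ : ContDiffAt ℝ 2 f₂ z := (h₂.analyticAt hΩ hz).contDiffAt.restrict_scalars ℝ
    have : ContDiffAt ℝ 2 (fun z => l₁ * ‖f₁ z‖ ^ 2 + l₂ * ‖f₂ z‖ ^ 2) z :=
      (contDiffAt_const.mul (c₁.norm_sq ℝ)).add (contDiffAt_const.mul (c₂.norm_sq ℝ))
    exact this.congr_of_eventuallyEq (eventually_of_mem hn hT)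
  have eT : ∀ z ∈ Ω, (T z : ℂ) = (l₁ * f₁ z) * conj (f₁ z) + (l₂ * f₂ z) * conj (f₂ z) := by
    intro z hz
    rw [hT z hz, mul_assoc, mul_assoc, Complex.mul_conj, Complex.mul_conj,
      Complex.normSq_eq_norm_sq, Complex.normSq_eq_norm_sq]
    push_cast
    rfl
  have eT1 : ∀ z ∈ Ω, dz (fun w => (T w : ℂ)) z
      = (l₁ * deriv f₁ z) * conj (f₁ z) + (l₂ * deriv f₂ z) * conj (f₂ z) := fun z hz => by
    have g₁ := (h₁.analyticAt hΩ hz).differentiableAt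
    have g₂ := (h₂.analyticAt hΩ hz).differentiableAt
    rw [dz_congr (eventually_of_mem (hΩ.mem_nhds hz) eT),
      dz_mul_conj_add (g₁.const_mul _) (g₂.const_mul _) g₁ g₂, deriv_const_mul _ g₁,
      deriv_const_mul _ g₂]
  have g₁ := h₁.analyticAt hΩ hz
  have g₂ := h₂.analyticAt hΩ hz
  have e₁ := h₁.hyperOp_eq_zero z hz
  have e₂ := h₂.hyperOp_eq_zero z hz
  rw [hyperOp] at e₁ e₂
  rw [pde_iff hzp, dz_congr (eventually_of_mem hn eT1),
    dz_mul_conj_add (g₁.deriv.differentiableAt.const_mul _)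
      (g₂.deriv.differentiableAt.const_mul _) g₁.differentiableAt g₂.differentiableAt,
    deriv_const_mul _ g₁.deriv.differentiableAt, deriv_const_mul _ g₂.deriv.differentiableAt,
    eT1 z hz, eT z hz]
  linear_combination l₁ * conj (f₁ z) * e₁ + l₂ * conj (f₂ z) * e₂

/-! ### Monodromy around `0`. -/

/-- The plane cut along `[0, ∞)`. -/
def rightCutPlane : Set ℂ := {z : ℂ | -z ∈ Complex.slitPlane}

theorem mem_rightCutPlane_iff {z : ℂ} : z ∈ rightCutPlane ↔ z.re < 0 ∨ z.im ≠ 0 := by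
  change -z ∈ Complex.slitPlane ↔ _
  rw [Complex.mem_slitPlane_iff]
  simp

theorem isOpen_rightCutPlane : IsOpen rightCutPlane :=
  Complex.isOpen_slitPlane.preimage continuous_neg

theorem isPreconnected_rightCutPlane : IsPreconnected rightCutPlane := by
  have : rightCutPlane = (fun z : ℂ => -z) '' Complex.slitPlane := by
    ext z
    exact ⟨fun h => ⟨-z, h, by ring⟩, by rintro ⟨w, hw, rfl⟩; simpa [rightCutPlane] using hw⟩
  rw [this]
  exact (Complex.starConvex_one_slitPlane.isPathConnected
    (by simp)).isConnected.isPreconnected.image _ (by fun_prop)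

theorem rightCutPlane_subset_cutPlane : rightCutPlane ⊆ cutPlane := fun z hz h => by
  rw [mem_rightCutPlane_iff] at hz
  rcases hz with hz | hz
  · linarith [h.2]
  · exact hz h.1

theorem zero_notMem_rightCutPlane : (0 : ℂ) ∉ rightCutPlane := by
  simp [mem_rightCutPlane_iff]

theorem rightCutPlane_subset_puncturedPlane : rightCutPlane ⊆ puncturedPlane := fun z hz h => by
  rcases h with rfl | rfl
  · exact zero_notMem_rightCutPlane hz
  · simp only [mem_rightCutPlane_iff, Complex.one_re, Complex.one_im] at hz
    norm_num at hz

/-- The variant of `F₊` whose branch cut is `[0, ∞)`. -/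
def FplusNeg (a b c : ℝ) (z : ℂ) : ℂ :=
  (-z) ^ (1 - (c : ℂ)) * gauss2F1 (1 + a - c) (1 + b - c) (2 - c) z

/-- The exponent is real, so the modulus of the power does not depend on the branch. Hence `|F₊|²`
has no jump on the negative axis. -/
theorem norm_FplusNeg (a b c : ℝ) (z : ℂ) : ‖FplusNeg a b c z‖ = ‖Fplus a b c z‖ := by
  have e : (1 : ℂ) - c = ((1 - c : ℝ) : ℂ) := by push_cast; rfl
  rw [FplusNeg, Fplus, norm_mul, norm_mul, e, Complex.norm_cpow_real, Complex.norm_cpow_real,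
    norm_neg]

theorem isHyperSol_FplusNeg (a b : ℝ) {c : ℝ} (hc : ∀ n : ℤ, c ≠ n) :
    IsHyperSol a b c (FplusNeg a b c) rightCutPlane :=
  isHyperSol_branch hc isOpen_rightCutPlane rightCutPlane_subset_cutPlane
    zero_notMem_rightCutPlane fun _ hz => hasDerivAt_neg_cpow_div hz

theorem wronskian_Fminus_FplusNeg_ne_zero (a b : ℝ) {c : ℝ} (hc : ∀ n : ℤ, c ≠ n) {z : ℂ}
    (hz : z ∈ rightCutPlane) : wronskian (Fminus a b c) (FplusNeg a b c) z ≠ 0 := by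
  have h0 : z ≠ 0 := fun h => zero_notMem_rightCutPlane (h ▸ hz)
  exact wronskian_ne_zero hc (rightCutPlane_subset_cutPlane hz) h0 (hasDerivAt_neg_cpow_div hz)
    (by simp [Complex.cpow_eq_zero_iff, h0])

theorem FplusNeg_of_im_pos (a b c : ℝ) {z : ℂ} (hz : 0 < z.im) :
    FplusNeg a b c z = Complex.exp (-(Real.pi * (1 - c) : ℝ) * Complex.I) * Fplus a b c z := by
  have h0 : z ≠ 0 := fun h => by simp [h] at hz
  rw [FplusNeg, Fplus, ← mul_assoc, Complex.cpow_def_of_ne_zero (neg_ne_zero.2 h0),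
    Complex.cpow_def_of_ne_zero h0, ← Complex.exp_add, Complex.log, Complex.log, norm_neg,
    Complex.arg_neg_eq_arg_sub_pi_of_im_pos hz]
  congr 2
  push_cast
  ring

theorem FplusNeg_of_im_neg (a b c : ℝ) {z : ℂ} (hz : z.im < 0) :
    FplusNeg a b c z = conj (Complex.exp (-(Real.pi * (1 - c) : ℝ) * Complex.I)) * Fplus a b c z := by
  have h0 : z ≠ 0 := fun h => by simp [h] at hz
  rw [FplusNeg, Fplus, ← mul_assoc, Complex.cpow_def_of_ne_zero (neg_ne_zero.2 h0),
    Complex.cpow_def_of_ne_zero h0, ← Complex.exp_conj, ← Complex.exp_add, Complex.log, Complex.log,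
    norm_neg, Complex.arg_neg_eq_arg_add_pi_of_im_neg hz]
  congr 2
  simp only [map_mul, map_neg, Complex.conj_I, Complex.conj_ofReal]
  push_cast
  ring

theorem monodromy_mul_conj (p : ℝ) :
    Complex.exp (-(p : ℂ) * Complex.I) * conj (Complex.exp (-(p : ℂ) * Complex.I)) = 1 := by
  rw [← Complex.exp_conj, ← Complex.exp_add]
  simp

/-- Equality would put `π(1 - c)` in `πℤ`, that is, make `c` an integer. -/
theorem monodromy_ne_conj {c : ℝ} (hc : ∀ n : ℤ, c ≠ n) :
    Complex.exp (-(Real.pi * (1 - c) : ℝ) * Complex.I)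
      ≠ conj (Complex.exp (-(Real.pi * (1 - c) : ℝ) * Complex.I)) := by
  intro h
  rw [← Complex.exp_conj, Complex.exp_eq_exp_iff_exists_int] at h
  obtain ⟨n, hn⟩ := h
  simp only [map_mul, map_neg, Complex.conj_I, Complex.conj_ofReal] at hn
  have h1 : ((Real.pi * (1 - c) : ℝ) : ℂ) = ((-n * Real.pi : ℝ) : ℂ) := by
    apply mul_right_cancel₀ (mul_ne_zero two_ne_zero Complex.I_ne_zero)
    push_cast at hn ⊢
    linear_combination -hn
  have h2 : Real.pi * (1 - c) = -n * Real.pi := by exact_mod_cast h1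
  have h3 : 1 - c = -n := by
    apply mul_left_cancel₀ Real.pi_ne_zero
    linarith
  exact hc (1 + n) (by push_cast; linarith)

theorem isOpen_upper : IsOpen {z : ℂ | 0 < z.im} :=
  isOpen_lt continuous_const Complex.continuous_im

theorem isOpen_lower : IsOpen {z : ℂ | z.im < 0} :=
  isOpen_lt Complex.continuous_im continuous_const

/-- Comparison of two bilinear expressions whose second basis functions differ by a factor. -/
theorem bilinear_form_compare {f₁ f₂ g₂ : ℂ → ℂ} {e : ℂ} {Ω : Set ℂ} (hΩ : IsOpen Ω)
    (hne : Ω.Nonempty) (hf₁ : DifferentiableOn ℂ f₁ Ω) (hf₂ : DifferentiableOn ℂ f₂ Ω)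
    (hw : ∀ z ∈ Ω, wronskian f₁ f₂ z ≠ 0) (hg : ∀ z ∈ Ω, g₂ z = e * f₂ z) {τ : ℂ → ℂ}
    {m₁₁ m₁₂ m₂₁ m₂₂ n₁₁ n₁₂ n₂₁ n₂₂ : ℂ}
    (hm : ∀ z ∈ Ω, τ z = (m₁₁ * f₁ z + m₁₂ * f₂ z) * conj (f₁ z)
      + (m₂₁ * f₁ z + m₂₂ * f₂ z) * conj (f₂ z))
    (hn : ∀ z ∈ Ω, τ z = (n₁₁ * f₁ z + n₁₂ * g₂ z) * conj (f₁ z)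
      + (n₂₁ * f₁ z + n₂₂ * g₂ z) * conj (g₂ z)) :
    m₁₁ = n₁₁ ∧ m₁₂ = n₁₂ * e ∧ m₂₁ = n₂₁ * conj e ∧ m₂₂ = n₂₂ * (e * conj e) := by
  have h := bilinear_form_eq_zero (m₁₁ := m₁₁ - n₁₁) (m₁₂ := m₁₂ - n₁₂ * e)
    (m₂₁ := m₂₁ - n₂₁ * conj e) (m₂₂ := m₂₂ - n₂₂ * (e * conj e)) hΩ hne hf₁ hf₂ hw fun z hz => by
    have h1 := hm z hz
    have h2 := hn z hz
    rw [hg z hz, map_mul] at h2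
    linear_combination h2 - h1
  simpa only [sub_eq_zero] using h

theorem eq_re_of_eq_mul_conj {t : ℝ} {m₁ m₂ u v : ℂ}
    (h : (t : ℂ) = m₁ * u * conj u + m₂ * v * conj v) :
    t = m₁.re * ‖u‖ ^ 2 + m₂.re * ‖v‖ ^ 2 := by
  rw [mul_assoc, mul_assoc, Complex.mul_conj, Complex.mul_conj, Complex.normSq_eq_norm_sq,
    Complex.normSq_eq_norm_sq] at h
  have := congrArg Complex.re h
  rwa [Complex.add_re, Complex.re_mul_ofReal, Complex.re_mul_ofReal, Complex.ofReal_re] at this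

/-- `T` has a bilinear form in `F₋, F₊` off the two cuts and another in `F₋` and `FplusNeg` off `[0,
∞)`. The bases differ by the factor `e` on the upper half-plane and `conj e` on the lower, so the
cross coefficients must satisfy `n e = n conj e` and vanish. -/
theorem IsSolution.exists_eq_combination {a b c : ℝ} (hc : ∀ n : ℤ, c ≠ n) {T : ℂ → ℝ}
    (hT : IsSolution a b c T) :
    ∃ l₁ l₂ : ℝ, ∀ z ∈ puncturedPlane ∩ cutPlane, T z = combination a b c l₁ l₂ z := by
  have hF := isHyperSol_Fminus a b hc
  have hP := isHyperSol_Fplus a b hc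
  obtain ⟨m₁₁, m₁₂, m₂₁, m₂₂, hm⟩ := exists_bilinear_form hT isOpen_doubleCutPlane
    isPreconnected_doubleCutPlane doubleCutPlane_subset_puncturedPlane
    (hF.mono doubleCutPlane_subset_cutPlane) hP
    fun z hz => wronskian_Fminus_Fplus_ne_zero a b hc hz
  obtain ⟨n₁₁, n₁₂, n₂₁, n₂₂, hn⟩ := exists_bilinear_form hT isOpen_rightCutPlane
    isPreconnected_rightCutPlane rightCutPlane_subset_puncturedPlane
    (hF.mono rightCutPlane_subset_cutPlane) (isHyperSol_FplusNeg a b hc)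
    fun z hz => wronskian_Fminus_FplusNeg_ne_zero a b hc hz
  set e := Complex.exp (-(Real.pi * (1 - c) : ℝ) * Complex.I) with he
  have hee : e * conj e = 1 := monodromy_mul_conj _
  have hne : e ≠ conj e := monodromy_ne_conj hc
  have su : {z : ℂ | 0 < z.im} ⊆ doubleCutPlane := fun z hz =>
    mem_doubleCutPlane_iff.2 (Or.inl (ne_of_gt hz))
  have sl : {z : ℂ | z.im < 0} ⊆ doubleCutPlane := fun z hz =>
    mem_doubleCutPlane_iff.2 (Or.inl (ne_of_lt hz))
  have su' : {z : ℂ | 0 < z.im} ⊆ rightCutPlane := fun z hz =>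
    mem_rightCutPlane_iff.2 (Or.inr (ne_of_gt hz))
  have sl' : {z : ℂ | z.im < 0} ⊆ rightCutPlane := fun z hz =>
    mem_rightCutPlane_iff.2 (Or.inr (ne_of_lt hz))
  have hd := hF.differentiableOn.mono doubleCutPlane_subset_cutPlane
  obtain ⟨u11, u12, u21, u22⟩ := bilinear_form_compare isOpen_upper ⟨Complex.I, by simp⟩
    (hd.mono su) (hP.differentiableOn.mono su)
    (fun z hz => wronskian_Fminus_Fplus_ne_zero a b hc (su hz))
    (fun z hz => FplusNeg_of_im_pos a b c hz) (fun z hz => hm z (su hz)) fun z hz => hn z (su' hz)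
  obtain ⟨-, l12, l21, -⟩ := bilinear_form_compare isOpen_lower ⟨-Complex.I, by simp⟩
    (hd.mono sl) (hP.differentiableOn.mono sl)
    (fun z hz => wronskian_Fminus_Fplus_ne_zero a b hc (sl hz))
    (fun z hz => FplusNeg_of_im_neg a b c hz) (fun z hz => hm z (sl hz)) fun z hz => hn z (sl' hz)
  rw [← he] at *
  rw [Complex.conj_conj] at l21
  have hn12 : n₁₂ = 0 := by
    by_contra h
    exact hne (mul_left_cancel₀ h (u12.symm.trans l12))
  have hn21 : n₂₁ = 0 := by
    by_contra h
    exact hne (mul_left_cancel₀ h (l21.symm.trans u21))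
  rw [hn12, zero_mul] at u12
  rw [hn21, zero_mul] at u21
  rw [hee, mul_one] at u22
  refine ⟨m₁₁.re, m₂₂.re, fun z ⟨hz, hzc⟩ => ?_⟩
  rw [combination]
  by_cases hs : z ∈ Complex.slitPlane
  · refine eq_re_of_eq_mul_conj ?_
    rw [hm z ⟨hzc, hs⟩, u12, u21]
    ring
  -- On the negative axis `F₊` is on its cut, and the form in `FplusNeg` is used; its diagonal
  -- coefficients agree because `e conj e = 1`.
  · have hz' : z ∈ rightCutPlane := by
      rw [Complex.mem_slitPlane_iff] at hs
      push Not at hs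
      rw [mem_rightCutPlane_iff]
      left
      refine lt_of_le_of_ne hs.1 fun h => ne_zero_of_mem_puncturedPlane hz ?_
      exact Complex.ext h hs.2
    rw [← norm_FplusNeg]
    refine eq_re_of_eq_mul_conj ?_
    rw [hn z hz', hn12, hn21, u11, u22]
    ring

/-! ### Reflection `z ↦ 1 - z` and the condition at `1`. -/

theorem dz_reflect {f : ℂ → ℂ} {z : ℂ} (hf : DifferentiableAt ℝ f (1 - z)) :
    dz (fun w => f (1 - w)) z = -dz f (1 - z) := by
  have h1 : HasFDerivAt (fun w : ℂ => 1 - w) (-ContinuousLinearMap.id ℝ ℂ) z :=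
    (hasFDerivAt_id z).const_sub 1
  have h2 : HasFDerivAt (fun w => f (1 - w)) _ z := hf.hasFDerivAt.comp z h1
  rw [dz, dz, h2.fderiv]
  simp
  ring

theorem one_sub_mem_puncturedPlane {z : ℂ} (hz : z ∈ puncturedPlane) : 1 - z ∈ puncturedPlane := by
  rintro (h | h)
  · exact one_sub_ne_zero_of_mem_puncturedPlane hz h
  · exact ne_zero_of_mem_puncturedPlane hz (by simpa using h)

theorem IsSolution.reflect {a b c : ℝ} {T : ℂ → ℝ} (hT : IsSolution a b c T) :
    IsSolution a b (a + b - c + 1) (fun z => T (1 - z)) := by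
  refine ⟨hT.1.comp (by fun_prop) fun z hz => one_sub_mem_puncturedPlane hz, fun z hz => ?_⟩
  have hz' := one_sub_mem_puncturedPlane hz
  have e1 : ∀ w ∈ puncturedPlane, dz (fun w => (T (1 - w) : ℂ)) w
      = (-1) * dz (fun w => (T w : ℂ)) (1 - w) := fun w hw => by
    rw [dz_reflect (f := fun w => (T w : ℂ))
      (differentiableAt_ofReal hT.1 (one_sub_mem_puncturedPlane hw)), neg_one_mul]
  have hd := differentiableAt_dz_ofReal hT.1 hz'
  have e2 : dz (dz (fun w => (T (1 - w) : ℂ))) z = dz (dz fun w => (T w : ℂ)) (1 - z) := by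
    rw [dz_congr (eventually_of_mem (isOpen_puncturedPlane.mem_nhds hz) e1),
      dz_const_mul (f := fun w => dz (fun w => (T w : ℂ)) (1 - w)) _
        (DifferentiableAt.comp (g := dz fun w => (T w : ℂ)) z hd (by fun_prop)),
      dz_reflect (f := dz fun w => (T w : ℂ)) hd]
    ring
  have h := (pde_iff hz').1 (hT.2 _ hz')
  rw [pde_iff hz, e2, e1 z hz]
  push_cast
  linear_combination h

theorem gammaRatio_mul_gammaRatio_minus (a b c : ℝ) :
    gammaRatio a b c * gammaRatio (c - a) (c - b) c
      = coeffMinus a b c * (Real.Gamma (c - a - b) * Real.Gamma (a + b - c)) := by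
  rw [gammaRatio, gammaRatio, coeffMinus, show c - (c - a) - (c - b) = a + b - c by ring,
    show c - (c - a) = a by ring, show c - (c - b) = b by ring]
  simp only [div_eq_mul_inv, mul_inv]
  ring

theorem gammaRatio_mul_gammaRatio_plus (a b c : ℝ) :
    gammaRatio (1 + a - c) (1 + b - c) (2 - c) * gammaRatio (1 - a) (1 - b) (2 - c)
      = coeffPlus a b c * (Real.Gamma (c - a - b) * Real.Gamma (a + b - c)) := by
  rw [gammaRatio, gammaRatio, coeffPlus,
    show 2 - c - (1 + a - c) - (1 + b - c) = c - a - b by ring,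
    show 2 - c - (1 + a - c) = 1 - a by ring, show 2 - c - (1 + b - c) = 1 - b by ring,
    show 2 - c - (1 - a) - (1 - b) = a + b - c by ring,
    show 2 - c - (1 - a) = a - c + 1 by ring, show 2 - c - (1 - b) = b - c + 1 by ring]
  simp only [div_eq_mul_inv, mul_inv]
  ring

theorem Gamma_mul_Gamma_ne_zero {s : ℝ} (hs : ∀ n : ℤ, s ≠ n) (t : ℝ) (ht : t = -s) :
    Real.Gamma s * Real.Gamma t ≠ 0 := by
  refine mul_ne_zero (Real.Gamma_ne_zero fun m h => hs (-m) (by push_cast; exact h))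
    (Real.Gamma_ne_zero fun m h => hs m ?_)
  push_cast
  linarith

/-- Both products of connection coefficients contain `Γ(c - a - b) Γ(a + b - c)`, which is nonzero
because `c - a - b` is not an integer. -/
theorem coeff_condition_iff {a b c : ℝ} (hcab : ∀ n : ℤ, c - a - b ≠ n) (l₁ l₂ : ℝ) :
    l₁ * coeffMinus a b c + l₂ * coeffPlus a b c = 0
      ↔ l₁ * (gammaRatio a b c * gammaRatio (c - a) (c - b) c)
        + l₂ * (gammaRatio (1 + a - c) (1 + b - c) (2 - c) * gammaRatio (1 - a) (1 - b) (2 - c))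
        = 0 := by
  have h := Gamma_mul_Gamma_ne_zero hcab (a + b - c) (by ring)
  rw [gammaRatio_mul_gammaRatio_minus, gammaRatio_mul_gammaRatio_plus,
    ← mul_assoc l₁, ← mul_assoc l₂, ← add_mul, mul_eq_zero]
  simp [h]

theorem ofReal_combination (a b c l₁ l₂ : ℝ) (z : ℂ) : (combination a b c l₁ l₂ z : ℂ)
    = l₁ * (Fminus a b c z * conj (Fminus a b c z))
      + l₂ * (Fplus a b c z * conj (Fplus a b c z)) := by
  rw [combination, Complex.mul_conj, Complex.mul_conj, Complex.normSq_eq_norm_sq,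
    Complex.normSq_eq_norm_sq]
  push_cast
  rfl

theorem combination_eq_zero {a b c l₁ l₂ : ℝ} (hc : ∀ n : ℤ, c ≠ n)
    (h : ∀ z ∈ doubleCutPlane, combination a b c l₁ l₂ z = 0) : l₁ = 0 ∧ l₂ = 0 := by
  have h1 := bilinear_form_eq_zero (m₁₁ := (l₁ : ℂ)) (m₁₂ := 0) (m₂₁ := 0) (m₂₂ := (l₂ : ℂ))
    isOpen_doubleCutPlane ⟨_, half_mem_doubleCutPlane⟩
    ((isHyperSol_Fminus a b hc).differentiableOn.mono doubleCutPlane_subset_cutPlane)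
    (isHyperSol_Fplus a b hc).differentiableOn
    (fun z hz => wronskian_Fminus_Fplus_ne_zero a b hc hz) fun z hz => by
      have := ofReal_combination a b c l₁ l₂ z
      rw [h z hz, Complex.ofReal_zero] at this
      linear_combination -this
  exact ⟨by exact_mod_cast h1.1, by exact_mod_cast h1.2.2.2⟩

/-- Inserting the real connection formulas turns the left side into a bilinear form in the basis at
`1`. The right side has no cross terms, so by independence the cross coefficient `l₁αβ + l₂α'β'` is
zero. -/
theorem condition_of_reflected_eq {a b c : ℝ} (hc : ∀ n : ℤ, c ≠ n)
    (hcab : ∀ n : ℤ, c - a - b ≠ n) {l₁ l₂ k₁ k₂ : ℝ}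
    (h : ∀ z ∈ doubleCutPlane,
      combination a b c l₁ l₂ z = combination a b (a + b - c + 1) k₁ k₂ (1 - z)) :
    l₁ * coeffMinus a b c + l₂ * coeffPlus a b c = 0 := by
  have hr := reflected_ne_int hcab
  rw [coeff_condition_iff hcab]
  set α := gammaRatio a b c with hα
  set β := gammaRatio (c - a) (c - b) c with hβ
  set α' := gammaRatio (1 + a - c) (1 + b - c) (2 - c) with hα'
  set β' := gammaRatio (1 - a) (1 - b) (2 - c) with hβ'
  have h1 := bilinear_form_eq_zero
    (f₁ := Fminus a b (a + b - c + 1)) (f₂ := Fplus a b (a + b - c + 1))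
    (m₁₁ := (l₁ * α ^ 2 + l₂ * α' ^ 2 - k₁ : ℂ)) (m₁₂ := (l₁ * (α * β) + l₂ * (α' * β') : ℂ))
    (m₂₁ := (l₁ * (α * β) + l₂ * (α' * β') : ℂ)) (m₂₂ := (l₁ * β ^ 2 + l₂ * β' ^ 2 - k₂ : ℂ))
    isOpen_doubleCutPlane ⟨_, half_mem_doubleCutPlane⟩
    ((isHyperSol_Fminus a b hr).differentiableOn.mono doubleCutPlane_subset_cutPlane)
    (isHyperSol_Fplus a b hr).differentiableOn
    (fun z hz => wronskian_Fminus_Fplus_ne_zero a b hr hz) fun w hw => by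
      have hz := one_sub_mem_doubleCutPlane hw
      have e := congrArg (fun x : ℝ => (x : ℂ)) (h _ hz)
      simp only [ofReal_combination] at e
      rw [Fminus_connection hc hcab hz, Fplus_connection hc hcab hz, sub_sub_cancel] at e
      simp only [map_add, map_mul, Complex.conj_ofReal] at e
      linear_combination e
  exact_mod_cast h1.2.1

/-- The condition kills the cross terms at `1`; `k₁, k₂` are the remaining diagonal coefficients. -/
theorem reflected_eq_of_condition {a b c : ℝ} (hc : ∀ n : ℤ, c ≠ n)
    (hcab : ∀ n : ℤ, c - a - b ≠ n) {l₁ l₂ : ℝ}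
    (h : l₁ * coeffMinus a b c + l₂ * coeffPlus a b c = 0) :
    ∃ k₁ k₂ : ℝ, ∀ z ∈ doubleCutPlane,
      combination a b c l₁ l₂ z = combination a b (a + b - c + 1) k₁ k₂ (1 - z) := by
  rw [coeff_condition_iff hcab] at h
  refine ⟨l₁ * gammaRatio a b c ^ 2 + l₂ * gammaRatio (1 + a - c) (1 + b - c) (2 - c) ^ 2,
    l₁ * gammaRatio (c - a) (c - b) c ^ 2 + l₂ * gammaRatio (1 - a) (1 - b) (2 - c) ^ 2,
    fun z hz => ?_⟩
  have h' := congrArg (fun x : ℝ => (x : ℂ)) h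
  apply Complex.ofReal_injective
  rw [ofReal_combination, ofReal_combination, Fminus_connection hc hcab hz,
    Fplus_connection hc hcab hz]
  simp only [map_add, map_mul, Complex.conj_ofReal]
  push_cast at h' ⊢
  linear_combination (Fminus a b (a + b - c + 1) (1 - z) * conj (Fplus a b (a + b - c + 1) (1 - z))
    + Fplus a b (a + b - c + 1) (1 - z) * conj (Fminus a b (a + b - c + 1) (1 - z))) * h'

/-! ### Construction of solutions and the dimension. -/

theorem IsSolution.hasForm {a b c l₁ l₂ : ℝ} {T : ℂ → ℝ} (hT : IsSolution a b c T)
    (h : ∀ z ∈ puncturedPlane ∩ cutPlane, T z = combination a b c l₁ l₂ z) :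
    HasForm a b c l₁ l₂ T := by
  refine ⟨h, fun x hx => ?_⟩
  have hx' : (x : ℂ) ∈ puncturedPlane := by
    rintro (h | h)
    · have : x = 0 := by exact_mod_cast h
      linarith
    · have : x = 1 := by exact_mod_cast (Set.mem_singleton_iff.1 h)
      linarith
  have hn := isOpen_puncturedPlane.mem_nhds hx'
  have hcont : Tendsto T (𝓝 (x : ℂ)) (𝓝 (T x)) := (hT.1.continuousOn.continuousAt hn)
  refine (hcont.mono_left nhdsWithin_le_nhds).congr' ?_
  filter_upwards [self_mem_nhdsWithin, mem_nhdsWithin_of_mem_nhds hn] with z hz hzp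
  exact h z ⟨hzp, hz⟩

theorem IsSolution.exists_hasForm {a b c : ℝ} (hc : ∀ n : ℤ, c ≠ n)
    (hcab : ∀ n : ℤ, c - a - b ≠ n) {T : ℂ → ℝ} (hT : IsSolution a b c T) :
    ∃ l₁ l₂ : ℝ, HasForm a b c l₁ l₂ T ∧ l₁ * coeffMinus a b c + l₂ * coeffPlus a b c = 0 := by
  obtain ⟨l₁, l₂, hl⟩ := hT.exists_eq_combination hc
  obtain ⟨k₁, k₂, hk⟩ := hT.reflect.exists_eq_combination (reflected_ne_int hcab)
  refine ⟨l₁, l₂, hT.hasForm hl, condition_of_reflected_eq (k₁ := k₁) (k₂ := k₂) hc hcab fun z hz => ?_⟩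
  rw [← hl z ⟨doubleCutPlane_subset_puncturedPlane hz, doubleCutPlane_subset_cutPlane hz⟩]
  have hz' := one_sub_mem_doubleCutPlane hz
  have := hk _ ⟨doubleCutPlane_subset_puncturedPlane hz', doubleCutPlane_subset_cutPlane hz'⟩
  rwa [sub_sub_cancel] at this

/-- Three open sets cover `ℂ ∖ {0, 1}`: the doubly cut plane, the plane without `[0, ∞)` for the
negative axis, and the plane without `(-∞, 1]` for `(1, ∞)`. On each, `T` is a real combination of
squared moduli of two holomorphic solutions. -/
theorem exists_isSolution_hasForm {a b c : ℝ} (hc : ∀ n : ℤ, c ≠ n)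
    (hcab : ∀ n : ℤ, c - a - b ≠ n) {l₁ l₂ : ℝ}
    (h : l₁ * coeffMinus a b c + l₂ * coeffPlus a b c = 0) :
    ∃ T, IsSolution a b c T ∧ HasForm a b c l₁ l₂ T := by
  classical
  have hr := reflected_ne_int hcab
  obtain ⟨k₁, k₂, hk⟩ := reflected_eq_of_condition hc hcab h
  -- On the cut the value is taken from the expression in the basis at `1`, which agrees with the
  -- other one off the real axis.
  set T : ℂ → ℝ := fun z => if z ∈ cutPlane then combination a b c l₁ l₂ z
    else combination a b (a + b - c + 1) k₁ k₂ (1 - z) with hTdef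
  have hT1 : ∀ z ∈ cutPlane, T z = combination a b c l₁ l₂ z := fun z hz => if_pos hz
  have hT2 : ∀ z, 1 - z ∈ rightCutPlane →
      T z = combination a b (a + b - c + 1) k₁ k₂ (1 - z) := fun z hz => by
    by_cases hzc : z ∈ cutPlane
    · rw [hT1 z hzc]
      refine hk z ⟨hzc, ?_⟩
      rw [mem_rightCutPlane_iff] at hz
      rw [Complex.mem_slitPlane_iff]
      rcases hz with hz | hz
      · left
        simp at hz
        linarith
      · right
        simpa using hz
    · exact if_neg hzc
  have key : ∀ z ∈ puncturedPlane, ContDiffAt ℝ 2 T z ∧ dz (dz (fun w => (T w : ℂ))) z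
      + ((c : ℂ) - z * ((a : ℂ) + (b : ℂ) + 1)) / (z * (1 - z)) * dz (fun w => (T w : ℂ)) z
      - ((a : ℂ) * (b : ℂ)) / (z * (1 - z)) * (T z : ℂ) = 0 := fun z hz => by
    by_cases hU : z ∈ doubleCutPlane
    · exact solution_of_eventuallyEq isOpen_doubleCutPlane
        ((isHyperSol_Fminus a b hc).mono doubleCutPlane_subset_cutPlane)
        (isHyperSol_Fplus a b hc) (fun w hw => hT1 w hw.1) hU hz
    by_cases hR : z ∈ rightCutPlane
    · refine solution_of_eventuallyEq isOpen_rightCutPlane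
        ((isHyperSol_Fminus a b hc).mono rightCutPlane_subset_cutPlane)
        (isHyperSol_FplusNeg a b hc) (l₁ := l₁) (l₂ := l₂) (fun w hw => ?_) hR hz
      rw [hT1 w (rightCutPlane_subset_cutPlane hw), norm_FplusNeg]
      rfl
    have hz' : z ∈ {w : ℂ | 1 - w ∈ rightCutPlane} := by
      change 1 - z ∈ rightCutPlane
      rw [mem_doubleCutPlane_iff] at hU
      rw [mem_rightCutPlane_iff] at hR ⊢
      push Not at hU hR
      left
      have h1 := one_sub_ne_zero_of_mem_puncturedPlane hz
      have h0 := ne_zero_of_mem_puncturedPlane hz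
      have hre0 : z.re ≠ 0 := fun h => h0 (Complex.ext h hR.2)
      have hre1 : z.re ≠ 1 := fun h => h1 (by
        rw [show z = 1 from Complex.ext h hR.2, sub_self])
      have := lt_of_le_of_ne (hU.2 (lt_of_le_of_ne hR.1 hre0.symm)) hre1.symm
      simp
      exact this
    refine solution_of_eventuallyEq (f₁ := fun w => Fminus a b (a + b - c + 1) (1 - w))
      (f₂ := fun w => FplusNeg a b (a + b - c + 1) (1 - w))
      (isOpen_rightCutPlane.preimage (continuous_const.sub continuous_id))
      ((isHyperSol_Fminus a b hr).reflect fun w hw => rightCutPlane_subset_cutPlane hw)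
      ((isHyperSol_FplusNeg a b hr).reflect fun w hw => hw) (l₁ := k₁) (l₂ := k₂)
      (fun w hw => ?_) hz' hz
    rw [hT2 w hw, norm_FplusNeg]
    rfl
  have hsol : IsSolution a b c T :=
    ⟨fun z hz => (key z hz).1.contDiffWithinAt, fun z hz => (key z hz).2⟩
  exact ⟨T, hsol, hsol.hasForm fun z hz => hT1 z hz.2⟩

theorem HasForm.eq_mul {a b c l₁ l₂ k₁ k₂ t : ℝ} {S T : ℂ → ℝ} (hS : HasForm a b c l₁ l₂ S)
    (hT : HasForm a b c k₁ k₂ T) (h₁ : l₁ = t * k₁) (h₂ : l₂ = t * k₂) {z : ℂ}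
    (hz : z ∈ puncturedPlane) : S z = t * T z := by
  have e : combination a b c l₁ l₂ = fun w => t * combination a b c k₁ k₂ w := by
    funext w
    rw [combination, combination, h₁, h₂]
    ring
  by_cases hzc : z ∈ cutPlane
  · rw [hS.1 z ⟨hz, hzc⟩, hT.1 z ⟨hz, hzc⟩, e]
  · obtain ⟨him, hre⟩ : z.im = 0 ∧ 1 ≤ z.re := not_not.1 hzc
    have hzx : z = (z.re : ℂ) := Complex.ext rfl (by simpa using him)
    have hx : 1 < z.re := lt_of_le_of_ne hre fun h => hz (by
      right
      rw [Set.mem_singleton_iff, hzx, ← h, Complex.ofReal_one])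
    -- Approaching the cut vertically stays in the cut plane, so the two limits can be compared
    -- along this path.
    have hlim : Tendsto (fun y : ℝ => (z.re : ℂ) + y * Complex.I) (𝓝[>] 0)
        (𝓝[cutPlane] (z.re : ℂ)) := by
      refine tendsto_nhdsWithin_iff.2 ⟨?_, ?_⟩
      · have : Continuous fun y : ℝ => (z.re : ℂ) + y * Complex.I := by fun_prop
        have h1 := this.tendsto 0
        simp only [Complex.ofReal_zero, zero_mul, add_zero] at h1
        exact h1.mono_left nhdsWithin_le_nhds
      · filter_upwards [self_mem_nhdsWithin] with y hy h
        have : y = 0 := by simpa using h.1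
        exact (ne_of_gt hy) this
    rw [hzx]
    have h1 := (hS.2 z.re hx).comp hlim
    have h2 := ((hT.2 z.re hx).const_mul t).comp hlim
    rw [e] at h1
    exact tendsto_nhds_unique h1 h2

theorem finrank_solutionSpace {a b c : ℝ} (hc : ∀ n : ℤ, c ≠ n) (hcab : ∀ n : ℤ, c - a - b ≠ n)
    (h : coeffMinus a b c ≠ 0 ∨ coeffPlus a b c ≠ 0) :
    Module.finrank ℝ (solutionSpace a b c) = 1 := by
  -- `(coeffPlus, -coeffMinus)` spans the kernel of the linear condition as soon as one coefficient
  -- is nonzero.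
  obtain ⟨T₀, hT₀, hF₀⟩ := exists_isSolution_hasForm hc hcab (l₁ := coeffPlus a b c)
    (l₂ := -coeffMinus a b c) (by ring)
  refine finrank_eq_one_iff'.2 ⟨⟨fun z => T₀ z, T₀, hT₀, fun _ => rfl⟩, fun h0 => ?_, ?_⟩
  · have h1 := combination_eq_zero hc fun z hz => by
      have hp := doubleCutPlane_subset_puncturedPlane hz
      rw [← hF₀.1 z ⟨hp, hz.1⟩]
      exact congrFun (congrArg Subtype.val h0) ⟨z, hp⟩
    rcases h with h | h
    · exact h (neg_eq_zero.1 h1.2)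
    · exact h h1.1
  · rintro ⟨u, T, hT, hu⟩
    obtain ⟨l₁, l₂, hF, hl⟩ := hT.exists_hasForm hc hcab
    obtain ⟨t, ht₁, ht₂⟩ : ∃ t, l₁ = t * coeffPlus a b c ∧ l₂ = t * -coeffMinus a b c := by
      rcases h with h | h
      · refine ⟨-l₂ / coeffMinus a b c, ?_, ?_⟩
        · field_simp
          linarith
        · field_simp
      · refine ⟨l₁ / coeffPlus a b c, ?_, ?_⟩
        · field_simp
        · field_simp
          linarith
    refine ⟨t, Subtype.ext (funext fun z => ?_)⟩
    change t * T₀ z = u z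
    rw [hu z, hF.eq_mul hF₀ ht₁ ht₂ z.2]

end

end HypergeoPDE

theorem lemma4p4 (a b c : ℝ) (hc : ∀ n : ℤ, c ≠ n) (hcab : ∀ n : ℤ, c - a - b ≠ n) :
    (∀ T : ℂ → ℝ, HypergeoPDE.IsSolution a b c T →
      ∃ l₁ l₂ : ℝ, HypergeoPDE.HasForm a b c l₁ l₂ T ∧
        l₁ * HypergeoPDE.coeffMinus a b c + l₂ * HypergeoPDE.coeffPlus a b c = 0) ∧
    ((HypergeoPDE.coeffMinus a b c ≠ 0 ∨ HypergeoPDE.coeffPlus a b c ≠ 0) →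
      Module.finrank ℝ (HypergeoPDE.solutionSpace a b c) = 1) :=
  ⟨fun _ hT => hT.exists_hasForm hc hcab, HypergeoPDE.finrank_solutionSpace hc hcab⟩
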